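/- Let $n\in\mathbb N$ and $I,J\subseteq\{0,1,\dots,n\}$ with $|I|\ge 2$ and $|J|\ge 3$. Write $\overline J=\{\overline j: j\in J\}$ for a disjoint copy of $J$, and order $I\sqcup\overline J$ by $i\prec\overline i\prec i+1$. For $i\in I$, $j\in J$ let $\ell(i,\overline j)\in\{0,\dots,n\}$ be the residue of $j-i$ modulo $n+1$. Two arcs $(i,\overline j),(i',\overline{j'})\in I\times\overline J$ *cyclically cross* if $\ell(i',\overline j)<\min(\ell(i,\overline j),\ell(i',\overline{j'}))$ or $\ell(i,\overline{j'})<\min(\ell(i,\overline j),\ell(i',\overline{j'}))$. Let $h:I\times\overline J\to\mathbb R$ be a *cyclically non-crossing height function*, i.e. $$h(i,\overline j)+h(i',\overline{j'})<h(i,\overline{j'})+h(i',\overline j)$$ whenever $i\ne i'$, $j\neq j'$ and $(i,\overline j),(i',\overline{j'})$ do not cyclically cross. For $i\in I$ the inverted tropical hyperplane $H_i=\{x\in\mathbb R^{\overline J}:\max_{\overline j}(x_{\overline j}-h(i,\overline j))\text{ is attained at least twice}\}$ has the closed regions $R_{i,\overline j}$ ($\overline j\in\overline J$) in which the maximum is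 attained at $\overline j$. The cells induced by the arrangement $(H_i)_{i\in I}$ are the nonempty intersections of regions that involve at least one region of each $H_i$, restricted to the hyperplane $x_{\max\overline J}=0$ (which represents $\mathbb R^{\overline J}/\mathbb R(1,\dots,1)$). The $(I,\overline J)$-cyclohedron $\mathrm{Cyclo}_{I,\overline J}(h)$ is the polyhedral complex of the bounded cells; its support is the union of its cells. Call two distinct elements of $\overline J$ cyclically consecutive if they are consecutive in $I\sqcup\overline J$, or are the first and the last element of $I\sqcup\overline J$. A classical $d$-dimensional cyclohedron is a polytope whose poset of nonempty faces is anti-isomorphic to the poset, under inclusion, of centrally symmetric dissections of a centrally symmetric convex $(2d+2)$-gon; a classical $d$-dimensional associahedron is one whose poset of nonempty faces is anti-isomorphic to the poset of dissections of a convex $(d+3)$-gon. (A dissection is a set of pairwise non-crossing diagonals.) **Theorem.** (1) The support of $\mathrm{Cyclo}_{I,\overline J}(h)$ is convex if and only if $\overline J$ has no cyclically consecutive pair of elements. (2) In this case, $\mathrm{Cyclo}_{I,\overline J}(h)$ is a regular polyhedral subdivision of its support, which is a classical cyclohedron of dimension $|J|-1$. (3) Whether or not the support is convex, every cell of $\mathrm{Cyclo}_{I,\overline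 J}(h)$ is a polytope that is combinatorially isomorphic to a Cartesian product of classical associahedra and at most one classical cyclohedron. -/

import Mathlib

/-! ## Polytopes, faces, subdivisions -/

section Polytopes

variable {E : Type*} [AddCommGroup E] [Module ℝ E]

/-- A (convex) polytope: the convex hull of finitely many points. -/
def IsPolytope (P : Set E) : Prop :=
  ∃ A : Finset E, P = convexHull ℝ (A : Set E)

/-- The poset of nonempty faces of `P` (including `P` itself, if it is nonempty), ordered by
inclusion. Faces are the sets on which a linear functional attains its maximum over `P`. -/
def NonemptyFace [TopologicalSpace E] (P : Set E) : Type _ :=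
  {F : Set E // F.Nonempty ∧ IsExposed ℝ P F}

instance [TopologicalSpace E] (P : Set E) : PartialOrder (NonemptyFace P) :=
  inferInstanceAs (PartialOrder {F : Set E // F.Nonempty ∧ IsExposed ℝ P F})

/-- The support of a polyhedral complex, given by its collection of nonempty cells. -/
def polyhedralSupport (𝒞 : Set (Set E)) : Set E := ⋃ C ∈ 𝒞, C

/-- `𝒞` is the collection of (nonempty) cells of a polyhedral subdivision of `P`: finitely many
nonempty polytopes, closed under passing to nonempty faces, any two of which are disjoint or meet
in a common face, and which cover exactly `P`. -/
structure IsPolyhedralSubdivision [TopologicalSpace E] (𝒞 : Set (Set E)) (P : Set E) : Prop where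
  finite : 𝒞.Finite
  nonempty : ∀ C ∈ 𝒞, C.Nonempty
  polytope : ∀ C ∈ 𝒞, IsPolytope C
  face_mem : ∀ C ∈ 𝒞, ∀ F : Set E, F.Nonempty → IsExposed ℝ C F → F ∈ 𝒞
  inter : ∀ C ∈ 𝒞, ∀ D ∈ 𝒞, (C ∩ D).Nonempty →
    IsExposed ℝ C (C ∩ D) ∧ IsExposed ℝ D (C ∩ D)
  support_eq : polyhedralSupport 𝒞 = P

/-- A polyhedral subdivision of `P` is regular if there are finitely many points `a ∈ A` with
convex hull `P`, and heights `w a`, such that its cells are exactly the projections to `P` of the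
lower faces of the convex hull of the lifted points `(a, w a)`. A lower face is spanned by the
lifted points on the graph of an affine function `ℓ` such that no lifted point lies below this
graph and some lifted point lies on it. -/
def IsRegularSubdivision [TopologicalSpace E] (𝒞 : Set (Set E)) (P : Set E) : Prop :=
  IsPolyhedralSubdivision 𝒞 P ∧
  ∃ (A : Finset E) (w : E → ℝ), P = convexHull ℝ (A : Set E) ∧
    ∀ C : Set E, C ∈ 𝒞 ↔
      ∃ ℓ : E →ᵃ[ℝ] ℝ, (∀ a ∈ A, ℓ a ≤ w a) ∧ (∃ a ∈ A, ℓ a = w a) ∧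
        C = convexHull ℝ {a : E | a ∈ A ∧ ℓ a = w a}

end Polytopes

/-! ## Dissections of polygons, classical associahedra and cyclohedra -/

/-- A dissection of the convex polygon with vertices `0, 1, …, m - 1` in cyclic order, as a graph
on the vertices: its edges are diagonals (they join vertices that are not cyclically adjacent) and
no two of them cross. -/
structure IsDissection {m : ℕ} (D : SimpleGraph (Fin m)) : Prop where
  diagonal : ∀ a b : Fin m, D.Adj a b → a < b →
    (a : ℕ) + 1 < b ∧ ¬ ((a : ℕ) = 0 ∧ (b : ℕ) + 1 = m)
  noncrossing : ∀ a b c d : Fin m, D.Adj a b → D.Adj c d → ¬ (a < c ∧ c < b ∧ b < d)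

/-- The dissections of the `(d + 3)`-gon, ordered by inclusion. -/
abbrev Dissection (d : ℕ) : Type := {D : SimpleGraph (Fin (d + 3)) // IsDissection D}

/-- The centrally symmetric dissections of the `(2 d + 2)`-gon, ordered by inclusion. The central
symmetry of the polygon moves every vertex `d + 1` steps forward (addition in `Fin (2 * d + 2)` is
modulo `2 * d + 2`). -/
abbrev CSDissection (d : ℕ) : Type :=
  {D : SimpleGraph (Fin (2 * d + 2)) // IsDissection D ∧
    ∀ a b, D.Adj a b → D.Adj (a + ⟨d + 1, by omega⟩) (b + ⟨d + 1, by omega⟩)}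

/-- `P` is a (simple) classical `d`-dimensional cyclohedron: a polytope whose nonempty faces are
in inclusion-reversing bijection with the centrally symmetric dissections of the
`(2 d + 2)`-gon. -/
def IsCyclohedron {E : Type*} [AddCommGroup E] [Module ℝ E] [TopologicalSpace E]
    (d : ℕ) (P : Set E) : Prop :=
  IsPolytope P ∧ Nonempty (NonemptyFace P ≃o (CSDissection d)ᵒᵈ)

/-- `P` is a polytope combinatorially isomorphic to a Cartesian product of classical associahedra
and at most one classical cyclohedron. The nonempty faces of the `d`-dimensional associahedron are
in inclusion-reversing bijection with the dissections of the `(d + 3)`-gon, and the poset of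
nonempty faces of a Cartesian product of polytopes is the product of their posets of nonempty
faces. -/
def IsProductOfAssociahedraAndAtMostOneCyclohedron {E : Type*} [AddCommGroup E] [Module ℝ E]
    [TopologicalSpace E] (P : Set E) : Prop :=
  IsPolytope P ∧ ∃ (k : ℕ) (a : Fin k → ℕ),
    Nonempty (NonemptyFace P ≃o (∀ t, Dissection (a t))ᵒᵈ) ∨
    ∃ b : ℕ, Nonempty (NonemptyFace P ≃o ((∀ t, Dissection (a t)) × CSDissection b)ᵒᵈ)

/-! ## Cyclically non-crossing arcs and height functions -/

/-- The length `j - i` modulo `n + 1`, in `{0, …, n}`, of the arc `(i, j̄)`. -/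
def arcLength (n i j : ℕ) : ℤ := ((j : ℤ) - (i : ℤ)) % ((n : ℤ) + 1)

/-- The arcs `(i, j̄)` and `(i', j̄')` cyclically cross. -/
def CyclicallyCross (n i j i' j' : ℕ) : Prop :=
  (arcLength n i' j < arcLength n i j ∧ arcLength n i' j < arcLength n i' j') ∨
  (arcLength n i j' < arcLength n i j ∧ arcLength n i j' < arcLength n i' j')

/-- A height function on `I × J̄` is cyclically non-crossing if, for the two perfect matchings of
any two nodes of `I` with any two nodes of `J̄`, the cyclically non-crossing one has the smaller
total height. -/
def IsCyclicallyNoncrossingHeight (n : ℕ) {I J : Finset ℕ} (h : I → J → ℝ) : Prop :=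
  ∀ (i i' : I) (j j' : J), i ≠ i' → j ≠ j' → ¬ CyclicallyCross n i j i' j' →
    h i j + h i' j' < h i j' + h i' j

/-! ## The `(I, J̄)`-cyclohedron -/

section Cyclo

variable {I J : Finset ℕ}

/-- The `j̄`-th closed region of the inverted tropical hyperplane
`H_i = {x | max_j (x_j - h(i, j)) is attained twice}`, where the maximum is attained at `j`. -/
def tropicalRegion (h : I → J → ℝ) (i : I) (j : J) : Set (J → ℝ) :=
  {x | ∀ k : J, x k - h i k ≤ x j - h i j}

/-- The intersection of the regions indexed by the arcs of a subgraph `G` of the complete bipartite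
graph on `I` and `J̄`, within the hyperplane `x_{max J} = 0`, which represents
`ℝ^J / ℝ(1, …, 1)`. -/
def tropicalCell (h : I → J → ℝ) (G : Set (I × J)) : Set (J → ℝ) :=
  {x | (∀ j : J, (∀ k : J, k ≤ j) → x j = 0) ∧ ∀ p ∈ G, x ∈ tropicalRegion h p.1 p.2}

/-- The `(I, J̄)`-cyclohedron: the collection of the bounded (nonempty) cells induced by the
arrangement of the inverted tropical hyperplanes `H_i`, `i ∈ I`. A cell of the arrangement is an
intersection of regions that involves at least one region of each `H_i`. -/
def Cyclo (h : I → J → ℝ) : Set (Set (J → ℝ)) :=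
  {C | ∃ G : Set (I × J), (∀ i : I, ∃ j : J, (i, j) ∈ G) ∧
    C = tropicalCell h G ∧ C.Nonempty ∧ Bornology.IsBounded C}

end Cyclo

/-! ## Cyclically consecutive pairs -/

/-- The positions of the elements of `I ⊔ J̄` in the total order with `i ≺ ī ≺ i + 1`: the element
`i` is at position `2 i`, the element `j̄` at position `2 j + 1`. -/
def positions (I J : Finset ℕ) : Finset ℕ :=
  I.image (fun i => 2 * i) ∪ J.image (fun j => 2 * j + 1)

/-- `J̄` has two elements `j̄ ≺ j̄'` that are cyclically consecutive in `I ⊔ J̄`: either they are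
consecutive, or they are the first and the last element of `I ⊔ J̄`. -/
def HasCyclicallyConsecutivePair (I J : Finset ℕ) : Prop :=
  ∃ j ∈ J, ∃ j' ∈ J, j < j' ∧
    ((∀ p ∈ positions I J, ¬ (2 * j + 1 < p ∧ p < 2 * j' + 1)) ∨
      (∀ p ∈ positions I J, 2 * j + 1 ≤ p ∧ p ≤ 2 * j' + 1))

/-! The covector of a point records every arc (i, j) at which the maximum for i is attained. A
nonempty cell is the cell of the covector of a generic point in it, its faces correspond to the
larger covectors, and for |J| ≥ 2 it is bounded exactly when that covector leaves no j isolated. So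
the geometry is governed by the question which graphs are covectors.

A crossing pair of arcs never lies in a covector, because the swapped pair is strictly cheaper
(`isNoncrossing_covector`). Conversely, every noncrossing graph without isolated nodes is a covector
(`exists_covector_eq`). This is transport duality: minimizing a slack function yields a flow with
the degrees of the graph, supported on a covector, and a flow with noncrossing support is determined
by its marginals (`eq_of_isNoncrossing_support`). Hence the face poset of a bounded cell is opposite
to the poset of noncrossing graphs containing its covector.

Arcs between distinct points of a cyclic set correspond to half-turn orbits of diagonals of an even
polygon, so their noncrossing sets are the centrally symmetric dissections. The link of an arc
splits into a polygon and a smaller cyclic model; the link of a diagonal splits into two polygons.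
The arcs of I × J̄ embed in the cyclic model on I ⊔ J̄, and a graph without isolated nodes has the
same link in both, which gives the product structure of the cells.

Without a cyclically consecutive pair, each j has a predecessor ι j in I with nothing of J in
between. If any i attains its maximum at j, so does ι j; the support is therefore a single cell of
the subarrangement indexed by ι, and the same poset theorem identifies it as a cyclohedron. With
such a pair, `not_convex_support` exhibits a reentrant corner. Regularity comes from the convex
piecewise affine function that sums the maxima. -/

section Geometry

/-! ### Cells of the arrangement: covectors, faces, boundedness, vertices. -/

variable {I J : Type*}

/-- The covector of a point `x`: the arcs `(i, j)` such that `x` lies in the `j`-th region of the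
`i`-th inverted tropical hyperplane. -/
def covector (h : I → J → ℝ) (x : J → ℝ) : Set (I × J) :=
  {p | ∀ k : J, x k - h p.1 k ≤ x p.2 - h p.1 p.2}

/-- The points with `x j₀ = 0` whose covector contains `G`. -/
def cell (j₀ : J) (h : I → J → ℝ) (G : Set (I × J)) : Set (J → ℝ) :=
  {x | x j₀ = 0 ∧ G ⊆ covector h x}

/-- Every `i` lies on an arc of `G`. -/
def CoversLeft (G : Set (I × J)) : Prop := ∀ i : I, ∃ j : J, (i, j) ∈ G

/-- Every `j` lies on an arc of `G`. -/
def CoversRight (G : Set (I × J)) : Prop := ∀ j : J, ∃ i : I, (i, j) ∈ G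

/-- The bounded cells of the arrangement. -/
def boundedCells (j₀ : J) (h : I → J → ℝ) : Set (Set (J → ℝ)) :=
  {C | ∃ G : Set (I × J), CoversLeft G ∧ C = cell j₀ h G ∧ C.Nonempty ∧ Bornology.IsBounded C}

variable {h : I → J → ℝ} {j₀ : J} {G G' : Set (I × J)} {x y z : J → ℝ}

theorem CoversLeft.mono (hG : CoversLeft G) (hGG : G ⊆ G') : CoversLeft G' := fun i =>
  (hG i).imp fun _ hj => hGG hj

theorem CoversRight.mono (hG : CoversRight G) (hGG : G ⊆ G') : CoversRight G' := fun i =>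
  (hG i).imp fun _ hj => hGG hj

theorem cell_anti (hGG : G ⊆ G') : cell j₀ h G' ⊆ cell j₀ h G := fun _ hx =>
  ⟨hx.1, hGG.trans hx.2⟩

theorem cell_union : cell j₀ h G ∩ cell j₀ h G' = cell j₀ h (G ∪ G') := by
  ext x
  simp only [cell, Set.mem_inter_iff, Set.mem_ofPred_eq, Set.union_subset_iff]
  tauto

theorem coversLeft_covector [Finite J] [Nonempty J] (h : I → J → ℝ) (x : J → ℝ) :
    CoversLeft (covector h x) := fun i => by
  obtain ⟨j, hj⟩ := Finite.exists_max fun j => x j - h i j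
  exact ⟨j, hj⟩

theorem sub_eq_of_mem_covector {i : I} {j k : J} (hj : (i, j) ∈ covector h x)
    (hk : (i, k) ∈ covector h x) : x k - h i k = x j - h i j :=
  le_antisymm (hj k) (hk j)

theorem cell_convex : Convex ℝ (cell j₀ h G) := by
  intro x hx y hy a b ha hb hab
  refine ⟨by simp [hx.1, hy.1], fun p hp k => ?_⟩
  have h1 := mul_le_mul_of_nonneg_left (hx.2 hp k) ha
  have h2 := mul_le_mul_of_nonneg_left (hy.2 hp k) hb
  simp only [Pi.add_apply, Pi.smul_apply, smul_eq_mul]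
  have e : ∀ t : ℝ, t = a * t + b * t := fun t => by rw [← add_mul, hab, one_mul]
  rw [e (h p.1 k), e (h p.1 p.2)]
  linarith

theorem cell_isClosed : IsClosed (cell j₀ h G) := by
  have : cell j₀ h G = {x | x j₀ = 0} ∩ ⋂ p ∈ G, ⋂ k, {x | x k - h p.1 k ≤ x p.2 - h p.1 p.2} := by
    ext x
    simp [cell, covector, Set.subset_def]
  rw [this]
  refine (isClosed_eq (by fun_prop) (by fun_prop)).inter ?_
  exact isClosed_biInter fun p _ => isClosed_iInter fun k => isClosed_le (by fun_prop) (by fun_prop)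

/-- The maximum at each i is convex in the point, and a shared arc makes it affine on the segment;
an arc that is maximal at the midpoint must then be maximal at both ends. -/
theorem covector_midpoint_subset (hG : CoversLeft (covector h x ∩ covector h y)) :
    covector h (midpoint ℝ x y) ⊆ covector h x ∩ covector h y := by
  rintro ⟨i, j⟩ hij
  obtain ⟨k, hkx, hky⟩ := hG i
  have h1 := hkx j
  have h2 := hky j
  have h3 := hij k
  simp only [midpoint_eq_smul_add, Pi.smul_apply, Pi.add_apply, smul_eq_mul, invOf_eq_inv] at h1 h2 h3
  constructor
  · intro l
    have := hkx l
    simp only at this ⊢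
    linarith
  · intro l
    have := hky l
    simp only at this ⊢
    linarith

/-- Finiteness gives a minimal covector and directedness makes it least. A point attaining it serves
as a relative interior point of `S`. -/
theorem exists_covector_least [Finite I] [Finite J] {S : Set (J → ℝ)} (hS : S.Nonempty)
    (hd : ∀ x ∈ S, ∀ y ∈ S, ∃ z ∈ S, covector h z ⊆ covector h x ∩ covector h y) :
    ∃ x ∈ S, ∀ y ∈ S, covector h x ⊆ covector h y := by
  obtain ⟨x, hx, hmin⟩ := (Set.toFinite (covector h '' S)).exists_minimal (hS.image _)
  obtain ⟨x, hx, rfl⟩ := hx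
  refine ⟨x, hx, fun y hy => ?_⟩
  obtain ⟨z, hz, hzz⟩ := hd x hx y hy
  exact (hmin ⟨z, hz, rfl⟩ (hzz.trans Set.inter_subset_left)).trans (hzz.trans Set.inter_subset_right)

theorem Convex.exists_covector_least [Finite I] [Finite J] {S : Set (J → ℝ)} (hS : S.Nonempty)
    (hconv : Convex ℝ S) (hG : CoversLeft G) (hSG : S ⊆ cell j₀ h G) :
    ∃ x ∈ S, ∀ y ∈ S, covector h x ⊆ covector h y :=
  _root_.exists_covector_least hS fun x hx y hy => ⟨midpoint ℝ x y, hconv.midpoint_mem hx hy,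
    covector_midpoint_subset (hG.mono (Set.subset_inter (hSG hx).2 (hSG hy).2))⟩

theorem cell_eq_cell_covector [Finite I] [Finite J] (hG : CoversLeft G)
    (hne : (cell j₀ h G).Nonempty) :
    ∃ x ∈ cell j₀ h G, cell j₀ h G = cell j₀ h (covector h x) := by
  obtain ⟨x, hx, hmin⟩ := Convex.exists_covector_least hne cell_convex hG subset_rfl
  exact ⟨x, hx, Set.Subset.antisymm (fun y hy => ⟨hy.1, hmin y hy⟩) (cell_anti hx.2)⟩

theorem exists_eps_of_finite {ι : Type*} [Finite ι] (a b : ι → ℝ) (ha : ∀ t, 0 < a t) :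
    ∃ ε : ℝ, 0 < ε ∧ ∀ t, ε * b t < a t := by
  have : ∀ t, ∀ᶠ ε : ℝ in nhdsWithin 0 (Set.Ioi 0), ε * b t < a t := fun t => by
    have hc : Filter.Tendsto (fun ε : ℝ => ε * b t) (nhdsWithin 0 (Set.Ioi 0)) (nhds (0 * b t)) :=
      ((continuous_id.mul continuous_const).tendsto 0).mono_left nhdsWithin_le_nhds
    exact hc.eventually (gt_mem_nhds (by simpa using ha t))
  obtain ⟨ε, h1, h2⟩ := ((Filter.eventually_all.2 this).and self_mem_nhdsWithin).exists
  exact ⟨ε, h2, h1⟩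

/-- The point `x` is relatively interior to the cell of its own covector: inequalities tight at `x`
are tight on the whole cell, and the finitely many others leave room to move past `x`, away from
`y`. -/
theorem exists_extend [Finite I] [Finite J] (hx : x j₀ = 0)
    (hy : y ∈ cell j₀ h (covector h x)) :
    ∃ ε : ℝ, 0 < ε ∧ x - ε • (y - x) ∈ cell j₀ h (covector h x) := by
  classical
  let T := {q : (I × J) × J // q.1 ∈ covector h x ∧ (q.1.1, q.2) ∉ covector h x}
  have hpos : ∀ t : T, x t.1.2 - h t.1.1.1 t.1.2 < x t.1.1.2 - h t.1.1.1 t.1.1.2 := by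
    rintro ⟨⟨⟨i, j⟩, k⟩, h1, h2⟩
    refine lt_of_le_of_ne (h1 k) fun he => h2 fun l => ?_
    exact (h1 l).trans_eq he.symm
  obtain ⟨ε, hε, hlt⟩ := exists_eps_of_finite
    (fun t : T => (x t.1.1.2 - h t.1.1.1 t.1.1.2) - (x t.1.2 - h t.1.1.1 t.1.2))
    (fun t : T => (y t.1.1.2 - x t.1.1.2) - (y t.1.2 - x t.1.2)) fun t => sub_pos.2 (hpos t)
  refine ⟨ε, hε, by simp [hx, hy.1], ?_⟩
  rintro ⟨i, j⟩ hij k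
  simp only [Pi.sub_apply, Pi.smul_apply, smul_eq_mul]
  by_cases hk : (i, k) ∈ covector h x
  · have h1 := sub_eq_of_mem_covector hij hk
    have h2 := sub_eq_of_mem_covector (hy.2 hij) (hy.2 hk)
    have h3 : y k - x k = y j - x j := by linarith
    rw [h3]
    linarith
  · have := hlt ⟨((i, j), k), hij, hk⟩
    simp only at this
    linarith

/-- Take a generic `x` in the face. A segment from a point of its cell can be prolonged beyond `x`,
so a functional maximal at `x` is constant along it, and the whole cell lies in the face. -/
theorem exists_eq_cell_of_isExposed [Finite I] [Finite J] (hG : CoversLeft G)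
    {F : Set (J → ℝ)} (hF : F.Nonempty) (hexp : IsExposed ℝ (cell j₀ h G) F) :
    ∃ x ∈ F, F = cell j₀ h (covector h x) := by
  obtain ⟨l, hl⟩ := hexp hF
  have hsub : F ⊆ cell j₀ h G := hexp.subset
  obtain ⟨x, hx, hmin⟩ := Convex.exists_covector_least hF (hexp.convex cell_convex) hG hsub
  refine ⟨x, hx, Set.Subset.antisymm (fun y hy => ⟨(hsub hy).1, hmin y hy⟩) fun y hy => ?_⟩
  have hcc : cell j₀ h (covector h x) ⊆ cell j₀ h G := cell_anti (hsub hx).2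
  obtain ⟨ε, hε, hz⟩ := exists_extend (hsub hx).1 hy
  have hx' := hx
  rw [hl] at hx' ⊢
  have h1 := hx'.2 _ (hcc hz)
  simp only [map_sub, map_smul, smul_eq_mul] at h1
  have h2 : l x ≤ l y := by
    by_contra hlt
    have := mul_pos hε (sub_pos.2 (not_le.1 hlt))
    linarith
  exact ⟨hcc hy, fun w hw => (hx'.2 w hw).trans h2⟩

open Classical in
/-- The arc of `G` at `p.1` selected by `p`: `p` itself if it lies in `G`, and a fixed one if it
does not. -/
noncomputable def CoversLeft.select (hG : CoversLeft G) (p : I × J) : J :=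
  if p ∈ G then p.2 else (hG p.1).choose

theorem CoversLeft.select_mem (hG : CoversLeft G) (p : I × J) : (p.1, hG.select p) ∈ G := by
  unfold CoversLeft.select
  split_ifs with hp
  · exact hp
  · exact (hG p.1).choose_spec

theorem CoversLeft.select_of_mem (hG : CoversLeft G) {p : I × J} (hp : p ∈ G) :
    hG.select p = p.2 := if_pos hp

theorem cell_isExposed [Fintype I] [Fintype J] (hG : CoversLeft G) (hGG : G ⊆ G') :
    IsExposed ℝ (cell j₀ h G) (cell j₀ h G') := by
  rintro ⟨z, hz⟩
  have hG' := hG.mono hGG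
  choose t ht using hG
  -- Each summand is bounded on the cell of `G`, and its bound is attained precisely when the
  -- selected arc of `G'` is also maximal. Indexing by all pairs lets every arc of `G'` be selected
  -- at least once.
  let l : StrongDual ℝ (J → ℝ) := ∑ p : I × J,
    (ContinuousLinearMap.proj (R := ℝ) (φ := fun _ : J => ℝ) (hG'.select p) -
      ContinuousLinearMap.proj (t p.1))
  have hl : ∀ y, l y = ∑ p : I × J, (y (hG'.select p) - y (t p.1)) := fun y => by
    simp [l]
  have hle : ∀ y ∈ cell j₀ h G, ∀ p : I × J,
      y (hG'.select p) - y (t p.1) ≤ z (hG'.select p) - z (t p.1) := fun y hy p => by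
    have h1 := hy.2 (ht p.1) (hG'.select p)
    have h2 := hz.2 (hG'.select_mem p) (t p.1)
    simp only at h1 h2
    linarith
  refine ⟨l, Set.ext fun y => ⟨fun hy => ⟨cell_anti hGG hy, fun w hw => ?_⟩, fun hy => ?_⟩⟩
  · rw [hl, hl]
    refine Finset.sum_le_sum fun p _ => ?_
    have h1 := hw.2 (ht p.1) (hG'.select p)
    have h2 := hy.2 (hG'.select_mem p) (t p.1)
    simp only at h1 h2
    linarith
  · refine ⟨hy.1.1, fun p hp k => ?_⟩
    have h1 := hy.2 z (cell_anti hGG hz)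
    rw [hl, hl] at h1
    have h2 := (Finset.sum_eq_sum_iff_of_le fun p _ => hle y hy.1 p).1
      (le_antisymm (Finset.sum_le_sum fun p _ => hle y hy.1 p) h1) p (Finset.mem_univ _)
    rw [hG'.select_of_mem hp] at h2
    have h3 := sub_eq_of_mem_covector (hz.2 hp) (hz.2 (hGG (ht p.1)))
    have h4 := hy.1.2 (ht p.1) k
    simp only at h4
    linarith

/-- The covectors of normalized points that contain `G`. -/
def CovectorAbove (j₀ : J) (h : I → J → ℝ) (G : Set (I × J)) : Type _ :=
  {G' : Set (I × J) // G ⊆ G' ∧ ∃ x : J → ℝ, x j₀ = 0 ∧ covector h x = G'}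

instance : PartialOrder (CovectorAbove j₀ h G) :=
  inferInstanceAs (PartialOrder {G' : Set (I × J) // G ⊆ G' ∧ _})

theorem nonempty_orderIso_nonemptyFace_cell [Fintype I] [Fintype J] (hG : CoversLeft G) :
    Nonempty (NonemptyFace (cell j₀ h G) ≃o (CovectorAbove j₀ h G)ᵒᵈ) := by
  have hmem : ∀ G' : CovectorAbove j₀ h G, ∃ x ∈ cell j₀ h G'.1, covector h x = G'.1 := by
    rintro ⟨G', _, x, hx, rfl⟩
    exact ⟨x, ⟨hx, subset_rfl⟩, rfl⟩
  let Φ : (CovectorAbove j₀ h G)ᵒᵈ → NonemptyFace (cell j₀ h G) := fun G' =>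
    ⟨cell j₀ h (OrderDual.ofDual G').1, (hmem (OrderDual.ofDual G')).imp fun _ hx => hx.1,
      cell_isExposed hG (OrderDual.ofDual G').2.1⟩
  have hle : ∀ a b, Φ a ≤ Φ b ↔ a ≤ b := fun a b => by
    change cell j₀ h (OrderDual.ofDual a).1 ⊆ cell j₀ h (OrderDual.ofDual b).1 ↔
      (OrderDual.ofDual b).1 ⊆ (OrderDual.ofDual a).1
    refine ⟨fun hab => ?_, cell_anti⟩
    obtain ⟨x, hx, hxa⟩ := hmem (OrderDual.ofDual a)
    exact hxa ▸ (hab hx).2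
  refine ⟨(OrderIso.symm (RelIso.ofSurjective (OrderEmbedding.ofMapLEIff Φ hle) ?_))⟩
  rintro ⟨F, hF, hexp⟩
  obtain ⟨x, hx, hFx⟩ := exists_eq_cell_of_isExposed hG hF hexp
  have hx' := hexp.subset hx
  exact ⟨OrderDual.toDual ⟨covector h x, hx'.2, x, hx'.1, rfl⟩, Subtype.ext hFx.symm⟩

/-- An arc at `j` bounds `x j` from below, and an arc at `j₀` bounds all coordinates from above. -/
theorem cell_isBounded [Fintype J] (hG : CoversRight G) : Bornology.IsBounded (cell j₀ h G) := by
  choose t ht using hG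
  refine (Metric.isBounded_Icc (fun j => -(h (t j) j₀ - h (t j) j))
    (fun j => h (t j₀) j - h (t j₀) j₀)).subset fun x hx => ⟨fun j => ?_, fun j => ?_⟩
  · have := hx.2 (ht j) j₀
    simp only [hx.1] at this ⊢
    linarith
  · have := hx.2 (ht j₀) j
    simp only [hx.1] at this ⊢
    linarith

/-- If no arc ends at `j`, lowering the coordinate at `j` violates no constraint, so the cell
contains a ray. When `j = j₀`, normalization turns this into raising all other coordinates, which is
why a second element is needed. -/
theorem coversRight_of_isBounded [Fintype J] (hx : x j₀ = 0) (hJ : Nontrivial J)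
    (hb : Bornology.IsBounded (cell j₀ h (covector h x))) : CoversRight (covector h x) := by
  classical
  intro j
  by_contra! hj
  have hmem : ∀ t : ℝ, 0 ≤ t →
      (fun k => x k - (if k = j then t else 0) + (if j₀ = j then t else 0)) ∈
        cell j₀ h (covector h x) := fun t ht => by
    refine ⟨by simp [hx], ?_⟩
    rintro ⟨i, k⟩ hik l
    have hkj : k ≠ j := by rintro rfl; exact hj i hik
    have := hik l
    simp only [if_neg hkj] at this ⊢
    split_ifs <;> linarith
  obtain ⟨C, hC⟩ := hb.exists_norm_le
  obtain ⟨m, hm⟩ := exists_ne j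
  have hC0 : 0 ≤ C := (norm_nonneg _).trans (hC _ (hmem 0 le_rfl))
  have key : ∀ k : J, ∀ t : ℝ, 0 ≤ t →
      |x k - (if k = j then t else 0) + (if j₀ = j then t else 0)| ≤ C := fun k t ht =>
    (norm_le_pi_norm (fun k => x k - (if k = j then t else 0) + (if j₀ = j then t else 0)) k).trans
      (hC _ (hmem t ht))
  by_cases h0 : j₀ = j
  · have h1 := key m (C + |x m| + 1) (by positivity)
    rw [if_neg hm, if_pos h0] at h1
    have := (abs_le.1 h1).2
    have := neg_abs_le (x m)
    linarith
  · have h1 := key j (C + |x j| + 1) (by positivity)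
    rw [if_pos rfl, if_neg h0] at h1
    have := (abs_le.1 h1).1
    have := le_abs_self (x j)
    linarith

/-- With equal covectors, `x` lies in an open segment from `y` to a point beyond `x` in the cell, so
extremality forces `x = y`. Finitely many covectors leave finitely many vertices. -/
theorem extremePoints_cell_injOn [Finite I] [Finite J] :
    Set.InjOn (covector h) ((cell j₀ h G).extremePoints ℝ) := by
  intro x hx y hy hxy
  have hx' := mem_extremePoints.1 hx
  have hy' := mem_extremePoints.1 hy
  have hyx : y ∈ cell j₀ h (covector h x) := ⟨hy'.1.1, hxy.subset⟩
  obtain ⟨ε, hε, hz⟩ := exists_extend hx'.1.1 hyx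
  refine ((hx'.2 _ (cell_anti hx'.1.2 hz) y hy'.1 ?_).2).symm
  have hpos : 0 < 1 + ε := by positivity
  refine ⟨1 / (1 + ε), ε / (1 + ε), by positivity, by positivity, by field_simp, ?_⟩
  ext k
  simp only [Pi.add_apply, Pi.smul_apply, Pi.sub_apply, smul_eq_mul]
  field_simp
  ring

theorem extremePoints_cell_finite [Finite I] [Finite J] :
    ((cell j₀ h G).extremePoints ℝ).Finite :=
  Set.Finite.of_finite_image (Set.toFinite _) extremePoints_cell_injOn

theorem convexHull_extremePoints_cell [Finite I] [Fintype J]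
    (hb : Bornology.IsBounded (cell j₀ h G)) :
    convexHull ℝ ((cell j₀ h G).extremePoints ℝ) = cell j₀ h G := by
  have hc : IsCompact (cell j₀ h G) := Metric.isCompact_of_isClosed_isBounded cell_isClosed hb
  rw [← (extremePoints_cell_finite (I := I)).isCompact_convexHull (𝕜 := ℝ) |>.isClosed.closure_eq]
  exact closure_convexHull_extremePoints hc cell_convex

theorem cell_isPolytope [Finite I] [Fintype J]
    (hb : Bornology.IsBounded (cell j₀ h G)) : IsPolytope (cell j₀ h G) :=
  ⟨extremePoints_cell_finite.toFinset, by
    rw [Set.Finite.coe_toFinset, convexHull_extremePoints_cell hb]⟩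

end Geometry

/-! ### The bounded cells as a regular subdivision of their support. -/

section Subdivision

variable {I J : Type*} {h : I → J → ℝ} {j₀ : J} {G G' : Set (I × J)} {x y z : J → ℝ}

theorem mem_polyhedralSupport_boundedCells [Finite I] [Fintype J] [Nontrivial J] :
    x ∈ polyhedralSupport (boundedCells j₀ h) ↔ x j₀ = 0 ∧ CoversRight (covector h x) := by
  simp only [polyhedralSupport, Set.mem_iUnion, exists_prop]
  constructor
  · rintro ⟨C, ⟨G, hG, rfl, hne, hb⟩, hx⟩
    obtain ⟨z, hz, he⟩ := cell_eq_cell_covector hG hne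
    rw [he] at hb hx
    exact ⟨hx.1, (coversRight_of_isBounded hz.1 ‹_› hb).mono hx.2⟩
  · rintro ⟨hx, hG⟩
    exact ⟨_, ⟨covector h x, coversLeft_covector h x, rfl, ⟨x, hx, subset_rfl⟩,
      cell_isBounded hG⟩, hx, subset_rfl⟩

theorem isPolyhedralSubdivision_boundedCells [Fintype I] [Fintype J] :
    IsPolyhedralSubdivision (boundedCells j₀ h) (polyhedralSupport (boundedCells j₀ h)) where
  finite := (Set.finite_range (cell j₀ h)).subset <| by
    rintro C ⟨G, -, rfl, -⟩
    exact ⟨G, rfl⟩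
  nonempty := by
    rintro C ⟨G, -, rfl, hne, -⟩
    exact hne
  polytope := by
    rintro C ⟨G, -, rfl, -, hb⟩
    exact cell_isPolytope hb
  face_mem := by
    rintro C ⟨G, hG, rfl, -, hb⟩ F hF hexp
    obtain ⟨x, hx, he⟩ := exists_eq_cell_of_isExposed hG hF hexp
    exact ⟨covector h x, hG.mono (hexp.subset hx).2, he, hF, hb.subset hexp.subset⟩
  inter := by
    rintro C ⟨G, hG, rfl, -, -⟩ D ⟨G', hG', rfl, -, -⟩ -
    rw [cell_union]
    exact ⟨cell_isExposed hG Set.subset_union_left, cell_isExposed hG' Set.subset_union_right⟩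
  support_eq := rfl

/-- The sum over all pairs `(i, j)` of the maximum of the functions `x k - h i k`. -/
noncomputable def tropicalHeight [Fintype I] [Fintype J] (h : I → J → ℝ) (x : J → ℝ) : ℝ :=
  ∑ p : I × J, ⨆ k, (x k - h p.1 k)

theorem le_iSup_sub [Finite J] (h : I → J → ℝ) (x : J → ℝ) (i : I) (j : J) :
    x j - h i j ≤ ⨆ k, (x k - h i k) :=
  le_ciSup (f := fun k => x k - h i k) (Set.finite_range _).bddAbove j

theorem mem_covector_iff [Finite J] [Nonempty J] {p : I × J} :
    p ∈ covector h x ↔ x p.2 - h p.1 p.2 = ⨆ k, (x k - h p.1 k) :=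
  ⟨fun hp => (le_iSup_sub h x p.1 p.2).antisymm (ciSup_le hp), fun hp k =>
    (le_iSup_sub h x p.1 k).trans_eq hp.symm⟩

/-- The affine function that agrees with `tropicalHeight` on the cell of `G`. -/
noncomputable def CoversLeft.support [Fintype I] [Fintype J] (hG : CoversLeft G)
    (h : I → J → ℝ) : (J → ℝ) →ᵃ[ℝ] ℝ :=
  (∑ p : I × J, LinearMap.proj (R := ℝ) (φ := fun _ : J => ℝ) (hG.select p)).toAffineMap -
    AffineMap.const ℝ (J → ℝ) (∑ p : I × J, h p.1 (hG.select p))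

theorem CoversLeft.support_apply [Fintype I] [Fintype J] (hG : CoversLeft G) :
    hG.support h x = ∑ p : I × J, (x (hG.select p) - h p.1 (hG.select p)) := by
  simp [CoversLeft.support, Finset.sum_sub_distrib]

theorem CoversLeft.support_le [Fintype I] [Fintype J] (hG : CoversLeft G) :
    hG.support h x ≤ tropicalHeight h x := by
  rw [hG.support_apply]
  exact Finset.sum_le_sum fun p _ => le_iSup_sub h x p.1 _

/-- Equality in a sum of inequalities is equality in each term. The height counts each maximum |J|
times, so that a single height function has room for all arcs of `G` at a given i, whatever `G` is.
-/
theorem CoversLeft.support_eq_iff [Fintype I] [Fintype J] [Nonempty J] (hG : CoversLeft G) :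
    hG.support h x = tropicalHeight h x ↔ G ⊆ covector h x := by
  rw [hG.support_apply, tropicalHeight,
    Finset.sum_eq_sum_iff_of_le fun p _ => le_iSup_sub h x p.1 _]
  constructor
  · intro hp p hpG
    rw [mem_covector_iff, ← hG.select_of_mem hpG]
    exact hp p (Finset.mem_univ _)
  · intro hp p _
    exact mem_covector_iff.1 (hp (hG.select_mem p))

/-- The height is convex, and it is affine across a midpoint only if every maximizer there is also a
maximizer at both ends. -/
theorem tropicalHeight_midpoint_le [Fintype I] [Fintype J] [Nonempty J] :
    tropicalHeight h (midpoint ℝ x y) ≤ (tropicalHeight h x + tropicalHeight h y) / 2 ∧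
    ((tropicalHeight h x + tropicalHeight h y) / 2 ≤ tropicalHeight h (midpoint ℝ x y) →
      covector h (midpoint ℝ x y) ⊆ covector h x ∩ covector h y) := by
  have hm : ∀ k, midpoint ℝ x y k = (x k + y k) / 2 := fun k => by
    simp [midpoint_eq_smul_add]
    ring
  have hle : ∀ p : I × J, p ∈ Finset.univ → ⨆ k, (midpoint ℝ x y k - h p.1 k) ≤
      ((⨆ k, (x k - h p.1 k)) + ⨆ k, (y k - h p.1 k)) / 2 := fun p _ => ciSup_le fun k => by
    have h1 := le_iSup_sub h x p.1 k
    have h2 := le_iSup_sub h y p.1 k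
    rw [hm]
    linarith
  have he : (tropicalHeight h x + tropicalHeight h y) / 2 =
      ∑ p : I × J, ((⨆ k, (x k - h p.1 k)) + ⨆ k, (y k - h p.1 k)) / 2 := by
    rw [tropicalHeight, tropicalHeight, ← Finset.sum_add_distrib, Finset.sum_div]
  rw [he]
  refine ⟨Finset.sum_le_sum hle, fun hge p hp => ?_⟩
  have h0 := (Finset.sum_eq_sum_iff_of_le hle).1 (le_antisymm (Finset.sum_le_sum hle) hge) p
    (Finset.mem_univ _)
  rw [mem_covector_iff] at hp
  have h1 := le_iSup_sub h x p.1 p.2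
  have h2 := le_iSup_sub h y p.1 p.2
  have h3 := hm p.2
  exact ⟨mem_covector_iff.2 (by linarith), mem_covector_iff.2 (by linarith)⟩

/-- The cells are the domains of affinity of the convex function `tropicalHeight`, so lifting the
vertices of the cells to its graph induces the subdivision. Convexity of the support makes the hull
of these vertices equal to it and keeps contact sets closed under midpoints. -/
theorem isRegularSubdivision_boundedCells [Fintype I] [Fintype J] [Nontrivial J]
    (hconv : Convex ℝ (polyhedralSupport (boundedCells j₀ h))) :
    IsRegularSubdivision (boundedCells j₀ h) (polyhedralSupport (boundedCells j₀ h)) := by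
  classical
  set P := polyhedralSupport (boundedCells j₀ h) with hP
  refine ⟨isPolyhedralSubdivision_boundedCells, ?_⟩
  have hfin : (⋃ G : Set (I × J), (cell j₀ h G).extremePoints ℝ ∩ P).Finite :=
    Set.finite_iUnion fun G => extremePoints_cell_finite.inter_of_left _
  let A : Finset (J → ℝ) := hfin.toFinset
  have hcellP : ∀ x ∈ P, cell j₀ h (covector h x) ⊆ P := fun x hx y hy => by
    rw [hP, mem_polyhedralSupport_boundedCells] at hx ⊢
    exact ⟨hy.1, hx.2.mono hy.2⟩
  have hAP : (A : Set (J → ℝ)) ⊆ P := fun a ha => by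
    obtain ⟨G, hG⟩ := Set.mem_iUnion.1 (hfin.mem_toFinset.1 ha)
    exact hG.2
  have hull : ∀ G, Bornology.IsBounded (cell j₀ h G) → cell j₀ h G ⊆ P →
      convexHull ℝ ((A : Set (J → ℝ)) ∩ cell j₀ h G) = cell j₀ h G := fun G hb hGP => by
    refine (convexHull_min Set.inter_subset_right cell_convex).antisymm ?_
    conv_lhs => rw [← convexHull_extremePoints_cell hb]
    refine convexHull_mono fun a ha => ⟨hfin.mem_toFinset.2 (Set.mem_iUnion.2 ⟨G, ha, ?_⟩), ?_⟩
    · exact hGP (extremePoints_subset ha)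
    · exact extremePoints_subset ha
  have hbdd : ∀ x ∈ P, Bornology.IsBounded (cell j₀ h (covector h x)) := fun x hx =>
    cell_isBounded (mem_polyhedralSupport_boundedCells.1 hx).2
  have hself : ∀ x ∈ P, x ∈ cell j₀ h (covector h x) := fun x hx =>
    ⟨(mem_polyhedralSupport_boundedCells.1 hx).1, subset_rfl⟩
  refine ⟨A, tropicalHeight h, ?_, fun C => ⟨?_, ?_⟩⟩
  · refine Set.Subset.antisymm (fun x hx => ?_) (convexHull_min hAP hconv)
    have := hself x hx
    rw [← hull _ (hbdd x hx) (hcellP x hx)] at this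
    exact convexHull_mono Set.inter_subset_left this
  · rintro ⟨G, hG, rfl, hne, hb⟩
    have hGP : cell j₀ h G ⊆ P := Set.subset_biUnion_of_mem (u := id)
      (show cell j₀ h G ∈ boundedCells j₀ h from ⟨G, hG, rfl, hne, hb⟩)
    have hset : {a | a ∈ A ∧ hG.support h a = tropicalHeight h a} =
        (A : Set (J → ℝ)) ∩ cell j₀ h G := by
      ext a
      constructor
      · rintro ⟨ha, he⟩
        exact ⟨ha, (mem_polyhedralSupport_boundedCells.1 (hAP ha)).1, hG.support_eq_iff.1 he⟩
      · rintro ⟨ha, he⟩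
        exact ⟨ha, hG.support_eq_iff.2 he.2⟩
    refine ⟨hG.support h, fun a _ => hG.support_le, ?_, ?_⟩
    · rw [← hull G hb hGP, convexHull_nonempty_iff, ← hset] at hne
      exact hne
    · rw [hset, hull G hb hGP]
  · rintro ⟨ℓ, hle, ⟨a, haA, hatight⟩, rfl⟩
    have hcov := fun x : J → ℝ => coversLeft_covector h x
    have hleP : ∀ y ∈ P, ℓ y ≤ tropicalHeight h y := fun y hy => by
      -- On the cell of `y` the height is affine, so domination at the vertices of that cell extends
      -- to the whole cell.
      have hsub : convexHull ℝ ((A : Set (J → ℝ)) ∩ cell j₀ h (covector h y)) ⊆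
          {z | (ℓ - (hcov y).support h) z ≤ 0} := by
        refine convexHull_min (fun z hz => ?_) ?_
        · have h1 := hle z hz.1
          have h2 := (hcov y).support_eq_iff.2 hz.2.2
          change ℓ z - (hcov y).support h z ≤ 0
          linarith
        · exact (convex_Iic (0 : ℝ)).affine_preimage (ℓ - (hcov y).support h)
      rw [hull _ (hbdd y hy) (hcellP y hy)] at hsub
      have h1 : ℓ y - (hcov y).support h y ≤ 0 := hsub (hself y hy)
      rw [(hcov y).support_eq_iff.2 subset_rfl] at h1
      linarith
    let F := {y | y ∈ P ∧ ℓ y = tropicalHeight h y}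
    have hmid : ∀ u v : J → ℝ, ℓ (midpoint ℝ u v) = (ℓ u + ℓ v) / 2 := fun u v => by
      rw [AffineMap.map_midpoint, midpoint_eq_smul_add]
      simp
      ring
    obtain ⟨x, hxF, hmin⟩ := exists_covector_least (h := h) (S := F) ⟨a, hAP haA, hatight⟩
      fun u hu v hv => by
        have hmP := hconv.midpoint_mem hu.1 hv.1
        have h1 := hleP _ hmP
        have h2 := tropicalHeight_midpoint_le (h := h) (x := u) (y := v)
        rw [hmid, hu.2, hv.2] at h1
        exact ⟨_, ⟨hmP, by rw [hmid, hu.2, hv.2]; exact le_antisymm h1 h2.1⟩, h2.2 h1⟩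
    have hFx : F = cell j₀ h (covector h x) := by
      refine Set.Subset.antisymm (fun y hy => ⟨(hself y hy.1).1, hmin y hy⟩) fun y hy => ?_
      refine ⟨hcellP x hxF.1 hy, ?_⟩
      -- Along the prolonged segment both `ℓ` and the height are affine and they agree at `x`; since
      -- `ℓ` is nowhere larger, they agree at `y` as well.
      obtain ⟨ε, hε, hz⟩ := exists_extend (hself x hxF.1).1 hy
      have e1 := hleP _ (hcellP x hxF.1 hy)
      have e2 := hleP _ (hcellP x hxF.1 hz)
      have e3 := (hcov x).support_eq_iff.2 hy.2
      have e4 := (hcov x).support_eq_iff.2 hz.2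
      have e5 := (hcov x).support_eq_iff.2 (hself x hxF.1).2
      have hlin : ∀ g : (J → ℝ) →ᵃ[ℝ] ℝ, g (x - ε • (y - x)) = g x - ε * (g y - g x) := fun g => by
        have : x - ε • (y - x) = AffineMap.lineMap x y (-ε) := by
          simp [AffineMap.lineMap_apply]
          abel
        rw [this, AffineMap.apply_lineMap, AffineMap.lineMap_apply]
        simp
        ring
      rw [← e4, hlin, hlin, e5, e3, hxF.2] at e2
      have : ε * (tropicalHeight h y - ℓ y) ≤ 0 := by linarith
      have := nonpos_of_mul_nonpos_right this hε
      linarith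
    have hset : {a | a ∈ A ∧ ℓ a = tropicalHeight h a} =
        (A : Set (J → ℝ)) ∩ cell j₀ h (covector h x) := by
      rw [← hFx]
      ext b
      exact ⟨fun hb => ⟨hb.1, hAP hb.1, hb.2⟩, fun hb => ⟨hb.1, hb.2.2⟩⟩
    rw [hset, hull _ (hbdd x hxF.1) (hcellP x hxF.1)]
    exact ⟨covector h x, hcov x, rfl, ⟨x, hself x hxF.1⟩, hbdd x hxF.1⟩

end Subdivision

/-! ### Which graphs are covectors: transport duality and uniqueness of noncrossing flows. -/

section Existence

variable {I J : Type*}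

/-- The arcs `p` and `q` cross, where `l i j` is the length of the arc `(i, j)`. -/
def ArcCross (l : I → J → ℤ) (p q : I × J) : Prop :=
  (l q.1 p.2 < l p.1 p.2 ∧ l q.1 p.2 < l q.1 q.2) ∨ (l p.1 q.2 < l p.1 p.2 ∧ l p.1 q.2 < l q.1 q.2)

/-- No two elements of `S` are related by `r`. -/
def IsNoncrossing {A : Type*} (r : A → A → Prop) (S : Set A) : Prop := ∀ p ∈ S, ∀ q ∈ S, ¬ r p q

/-- Among the two perfect matchings of two left nodes and two right nodes, the noncrossing one has
the smaller height. -/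
def IsNoncrossingHeight (l : I → J → ℤ) (h : I → J → ℝ) : Prop :=
  ∀ (i i' : I) (j j' : J), i ≠ i' → j ≠ j' → ¬ ArcCross l (i, j) (i', j') →
    h i j + h i' j' < h i j' + h i' j

variable {l : I → J → ℤ} {h : I → J → ℝ} {j₀ : J} {G : Set (I × J)} {x : J → ℝ}

theorem ArcCross.symm {p q : I × J} (hpq : ArcCross l p q) : ArcCross l q p := by
  unfold ArcCross at *
  omega

/-- A matching crosses when an arc of the other matching is shorter than both of its own, which
cannot hold for both matchings. -/
theorem ArcCross.not_swap {i i' : I} {j j' : J} (hpq : ArcCross l (i, j) (i', j')) :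
    ¬ ArcCross l (i, j') (i', j) := by
  unfold ArcCross at *
  simp only at *
  omega

theorem ArcCross.fst_ne {p q : I × J} (hpq : ArcCross l p q) : p.1 ≠ q.1 := by
  intro he
  unfold ArcCross at hpq
  rw [he] at hpq
  omega

theorem ArcCross.snd_ne {p q : I × J} (hpq : ArcCross l p q) : p.2 ≠ q.2 := by
  intro he
  unfold ArcCross at hpq
  rw [he] at hpq
  omega

/-- For a crossing pair the swapped matching is noncrossing, hence strictly cheaper; adding the two
maximality inequalities says the opposite. -/
theorem IsNoncrossingHeight.isNoncrossing_covector (hh : IsNoncrossingHeight l h) (x : J → ℝ) :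
    IsNoncrossing (ArcCross l) (covector h x) := by
  rintro ⟨i, j⟩ hp ⟨i', j'⟩ hq hc
  have h1 := hp j'
  have h2 := hq j
  have h3 := hh i i' j' j hc.fst_ne hc.snd_ne.symm hc.not_swap
  simp only at h1 h2
  linarith

/-- Two flows with the same marginals and noncrossing supports are equal. -/
theorem eq_of_isNoncrossing_support [Fintype I] [Fintype J]
    (hl : ∀ i, Function.Injective (l i)) (hl' : ∀ j, Function.Injective fun i => l i j)
    {f g : I → J → ℝ} (hf0 : ∀ i j, 0 ≤ f i j) (hg0 : ∀ i j, 0 ≤ g i j)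
    (hrow : ∀ i, ∑ j, f i j = ∑ j, g i j) (hcol : ∀ j, ∑ i, f i j = ∑ i, g i j)
    (hf : IsNoncrossing (ArcCross l) {p | f p.1 p.2 ≠ 0})
    (hg : IsNoncrossing (ArcCross l) {p | g p.1 p.2 ≠ 0}) (i : I) (j : J) : f i j = g i j := by
  by_contra hne
  -- Consider a shortest arc where the flows differ. The flow that is smaller there must be larger
  -- on another arc of the same row and on one of the same column; both are longer, so these two
  -- arcs of its support cross.
  obtain ⟨⟨i, j⟩, hij, hmin⟩ := Set.exists_min_image {p : I × J | f p.1 p.2 ≠ g p.1 p.2}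
    (fun p => l p.1 p.2) (Set.toFinite _) ⟨(i, j), hne⟩
  have hmin' : ∀ a b, f a b ≠ g a b → l i j ≤ l a b := fun a b hab => hmin (a, b) hab
  clear hmin hne
  have main : ∀ f g : I → J → ℝ, (∀ i j, 0 ≤ g i j) → (∀ i, ∑ j, f i j = ∑ j, g i j) →
      (∀ j, ∑ i, f i j = ∑ i, g i j) → IsNoncrossing (ArcCross l) {p | f p.1 p.2 ≠ 0} →
      (∀ a b, f a b ≠ g a b → l i j ≤ l a b) → ¬ f i j < g i j := by
    intro f g hg0 hrow hcol hf hmin hlt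
    obtain ⟨j', hj'⟩ : ∃ j', g i j' < f i j' := by
      by_contra! hle
      exact (Finset.sum_lt_sum (fun b _ => hle b) ⟨j, Finset.mem_univ _, hlt⟩).ne (hrow i)
    obtain ⟨i', hi'⟩ : ∃ i', g i' j < f i' j := by
      by_contra! hle
      exact (Finset.sum_lt_sum (fun b _ => hle b) ⟨i, Finset.mem_univ _, hlt⟩).ne (hcol j)
    have h1 : l i j < l i j' := (hmin i j' hj'.ne').lt_of_ne fun he => by
      rw [hl i he] at hlt
      exact lt_asymm hlt hj'
    have h2 : l i j < l i' j := (hmin i' j hi'.ne').lt_of_ne fun he => by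
      rw [hl' j he] at hlt
      exact lt_asymm hlt hi'
    exact hf (i, j') ((hg0 i j').trans_lt hj').ne' (i', j) ((hg0 i' j).trans_lt hi').ne'
      (Or.inr ⟨h1, h2⟩)
  rcases lt_or_gt_of_ne hij with hlt | hlt
  · exact main f g hg0 hrow hcol hf hmin' hlt
  · exact main g f hf0 (fun i => (hrow i).symm) (fun j => (hcol j).symm) hg
      (fun a b hab => hmin' a b hab.symm) hlt

/-- The total slack of the arcs of `G` at `x`. -/
noncomputable def slack (h : I → J → ℝ) (G : Finset (I × J)) (x : J → ℝ) : ℝ :=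
  ∑ p ∈ G, ((⨆ k, (x k - h p.1 k)) - x p.2)

theorem continuous_iSup_sub [Fintype J] [Nonempty J] (g : J → ℝ) :
    Continuous fun x : J → ℝ => ⨆ k, (x k - g k) := by
  have : (fun x : J → ℝ => ⨆ k, (x k - g k)) =
      fun x => Finset.univ.sup' Finset.univ_nonempty fun k => x k - g k := by
    ext x
    rw [Finset.sup'_univ_eq_ciSup]
  rw [this]
  exact Continuous.finset_sup'_apply _ fun k _ => by fun_prop

/-- Each slack term is bounded below and every `j` has an arc in `G`, so a bound on the slack bounds
all normalized coordinates; the minimum is attained on a compact sublevel set. -/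
theorem exists_min_slack [Finite I] [Fintype J] (h : I → J → ℝ) (G : Finset (I × J))
    (hG : CoversRight (G : Set (I × J))) (j₀ : J) :
    ∃ x : J → ℝ, x j₀ = 0 ∧ ∀ y : J → ℝ, y j₀ = 0 → slack h G x ≤ slack h G y := by
  have : Nonempty J := ⟨j₀⟩
  have hcont : Continuous (slack h G) := continuous_finsetSum _ fun p _ =>
    (continuous_iSup_sub _).sub (continuous_apply _)
  let S := {x : J → ℝ | x j₀ = 0 ∧ slack h G x ≤ slack h G 0}
  have hclosed : IsClosed S := (isClosed_eq (continuous_apply _) continuous_const).inter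
    (isClosed_le hcont continuous_const)
  let K := slack h G 0 + ∑ p ∈ G, |h p.1 p.2|
  have hterm : ∀ x ∈ S, ∀ p ∈ G, ∀ k, x k - x p.2 ≤ K + h p.1 k := fun x hx p hp k => by
    have h1 : (⨆ k, (x k - h p.1 k)) - x p.2 + |h p.1 p.2| ≤
        ∑ q ∈ G, ((⨆ k, (x k - h q.1 k)) - x q.2 + |h q.1 q.2|) := by
      refine Finset.single_le_sum (f := fun q : I × J =>
        (⨆ k, (x k - h q.1 k)) - x q.2 + |h q.1 q.2|) (fun q _ => ?_) hp
      have := le_iSup_sub h x q.1 q.2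
      have := neg_abs_le (h q.1 q.2)
      have := le_abs_self (h q.1 q.2)
      linarith
    rw [Finset.sum_add_distrib] at h1
    have h2 := hx.2
    have h3 := le_iSup_sub h x p.1 k
    have h4 := abs_nonneg (h p.1 p.2)
    simp only [slack, K] at h2 ⊢
    linarith
  choose t ht using hG
  have hb : Bornology.IsBounded S := by
    refine (Metric.isBounded_Icc (fun j => -(K + h (t j) j₀)) (fun j => K + h (t j₀) j)).subset
      fun x hx => ⟨fun j => ?_, fun j => ?_⟩
    · have := hterm x hx _ (ht j) j₀
      simp only [hx.1] at this ⊢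
      linarith
    · have := hterm x hx _ (ht j₀) j
      simp only [hx.1] at this ⊢
      linarith
  obtain ⟨x, hx, hmin⟩ := (Metric.isCompact_of_isClosed_isBounded hclosed hb).exists_isMinOn
    (f := slack h G) ⟨0, rfl, le_rfl⟩ hcont.continuousOn
  refine ⟨x, hx.1, fun y hy => ?_⟩
  by_cases hy' : slack h G y ≤ slack h G 0
  · exact hmin ⟨hy, hy'⟩
  · exact hx.2.trans (not_le.1 hy').le

/-- This is the one-sided derivative of the slack in direction `u`: for small steps the maximum at
`i` grows at the rate of `u` at the active index `t i` where `u` is largest. -/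
theorem slack_add_le [Finite I] [Finite J] [Nonempty J] (h : I → J → ℝ) (G : Finset (I × J))
    (x u : J → ℝ) {t : I → J} (ht : ∀ i, (i, t i) ∈ covector h x)
    (hu : ∀ i k, (i, k) ∈ covector h x → u k ≤ u (t i)) :
    ∃ ε : ℝ, 0 < ε ∧ slack h G (x + ε • u) ≤ slack h G x + ε * ∑ p ∈ G, (u (t p.1) - u p.2) := by
  obtain ⟨ε, hε, hlt⟩ := exists_eps_of_finite
    (fun q : {q : I × J // q ∉ covector h x} =>
      (x (t q.1.1) - h q.1.1 (t q.1.1)) - (x q.1.2 - h q.1.1 q.1.2))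
    (fun q => u q.1.2 - u (t q.1.1)) fun ⟨⟨i, k⟩, hq⟩ => sub_pos.2 <|
      (ht i k).lt_of_ne fun he => hq fun l => (ht i l).trans_eq he.symm
  refine ⟨ε, hε, ?_⟩
  rw [slack, slack, Finset.mul_sum, ← Finset.sum_add_distrib]
  refine Finset.sum_le_sum fun p _ => ?_
  have h1 : (⨆ k, ((x + ε • u) k - h p.1 k)) ≤ (⨆ k, (x k - h p.1 k)) + ε * u (t p.1) := by
    refine ciSup_le fun k => ?_
    simp only [Pi.add_apply, Pi.smul_apply, smul_eq_mul]
    rw [← mem_covector_iff.1 (ht p.1)]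
    simp only
    by_cases hk : (p.1, k) ∈ covector h x
    · have h2 := ht p.1 k
      have h3 := mul_le_mul_of_nonneg_left (hu _ _ hk) hε.le
      simp only at h2
      linarith
    · have := hlt ⟨_, hk⟩
      simp only at this
      linarith
  simp only [Pi.add_apply, Pi.smul_apply, smul_eq_mul] at h1 ⊢
  linarith

/-- At a minimum of the total slack of `G`, the degrees of `G` are the marginals of a flow supported
on the covector. -/
theorem exists_flow_of_min_slack [Fintype I] [Fintype J] [DecidableEq I] [DecidableEq J]
    (h : I → J → ℝ) (G : Finset (I × J)) (hx : x j₀ = 0)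
    (hmin : ∀ y : J → ℝ, y j₀ = 0 → slack h G x ≤ slack h G y) :
    ∃ f : I → J → ℝ, (∀ i j, 0 ≤ f i j) ∧ (∀ i j, f i j ≠ 0 → (i, j) ∈ covector h x) ∧
      (∀ i, ∑ j, f i j = ∑ j, if (i, j) ∈ G then 1 else 0) ∧
      (∀ j, ∑ i, f i j = ∑ i, if (i, j) ∈ G then 1 else 0) := by
  have : Nonempty J := ⟨j₀⟩
  let g : I → J → ℝ := fun i j => if (i, j) ∈ G then 1 else 0
  -- The flows supported on the covector with the row sums of `G` form a compact convex set; the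
  -- question is whether its image under column sums contains the column degrees of `G`. If not, the
  -- separating functional `u` is a direction of descent for the slack.
  let Φ : Set (I → J → ℝ) := {f | (∀ i j, 0 ≤ f i j) ∧
    (∀ i j, (i, j) ∉ covector h x → f i j = 0) ∧ ∀ i, ∑ j, f i j = ∑ j, g i j}
  let col : (I → J → ℝ) →L[ℝ] (J → ℝ) := ContinuousLinearMap.pi fun j =>
    ∑ i, (ContinuousLinearMap.proj (R := ℝ) (φ := fun _ : J => ℝ) j).comp
      (ContinuousLinearMap.proj (R := ℝ) (φ := fun _ : I => J → ℝ) i)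
  have hcol : ∀ f j, col f j = ∑ i, f i j := fun f j => by
    simp [col]
  have hΦc : Convex ℝ Φ := by
    rintro f hf f' hf' a b ha hb hab
    refine ⟨fun i j => ?_, fun i j hij => ?_, fun i => ?_⟩
    · exact add_nonneg (mul_nonneg ha (hf.1 i j)) (mul_nonneg hb (hf'.1 i j))
    · simp [hf.2.1 i j hij, hf'.2.1 i j hij]
    · simp only [Pi.add_apply, Pi.smul_apply, smul_eq_mul, Finset.sum_add_distrib,
        ← Finset.mul_sum, hf.2.2 i, hf'.2.2 i]
      rw [← add_mul, hab, one_mul]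
  have hΦcl : IsClosed Φ := by
    have : Φ = (⋂ i, ⋂ j, {f | 0 ≤ f i j}) ∩ ((⋂ i, ⋂ j, ⋂ (_ : (i, j) ∉ covector h x),
        {f | f i j = 0}) ∩ ⋂ i, {f | ∑ j, f i j = ∑ j, g i j}) := by
      ext f
      simp [Φ]
    rw [this]
    refine IsClosed.inter ?_ (IsClosed.inter ?_ ?_)
    · exact isClosed_iInter fun i => isClosed_iInter fun j => isClosed_le (by fun_prop) (by fun_prop)
    · exact isClosed_iInter fun i => isClosed_iInter fun j => isClosed_iInter fun _ =>
        isClosed_eq (by fun_prop) (by fun_prop)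
    · exact isClosed_iInter fun i => isClosed_eq (by fun_prop) (by fun_prop)
  have hΦb : Bornology.IsBounded Φ := by
    refine (Metric.isBounded_Icc (0 : I → J → ℝ) (fun i _ => ∑ j, g i j)).subset
      fun f hf => ⟨hf.1, fun i j => ?_⟩
    exact (Finset.single_le_sum (f := fun j => f i j) (fun k _ => hf.1 i k)
      (Finset.mem_univ j)).trans_eq (hf.2.2 i)
  have hK : IsCompact (col '' Φ) :=
    (Metric.isCompact_of_isClosed_isBounded hΦcl hΦb).image col.continuous
  by_cases hmem : col g ∈ col '' Φ
  · obtain ⟨f, hf, hfg⟩ := hmem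
    refine ⟨f, hf.1, fun i j hij => ?_, hf.2.2, fun j => ?_⟩
    · by_contra hn
      exact hij (hf.2.1 i j hn)
    · have := congrFun hfg j
      rwa [hcol, hcol] at this
  · exfalso
    obtain ⟨L, s, hL, hs⟩ := geometric_hahn_banach_closed_point
      (hΦc.linear_image col.toLinearMap) hK.isClosed hmem
    let u : J → ℝ := fun j => L (Pi.single j 1)
    have hLu : ∀ f, L (col f) = ∑ i, ∑ j, f i j * u j := fun f => by
      have : col f = ∑ j, (∑ i, f i j) • (Pi.single j (1 : ℝ) : J → ℝ) := by
        ext k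
        simp [hcol, Finset.sum_apply, Pi.single_apply]
      rw [this, map_sum, Finset.sum_comm]
      exact Finset.sum_congr rfl fun j _ => by rw [map_smul, smul_eq_mul, Finset.sum_mul]
    have hne : ∀ i, ∃ t, (i, t) ∈ covector h x ∧ ∀ k, (i, k) ∈ covector h x → u k ≤ u t := fun i =>
      Set.exists_max_image {k | (i, k) ∈ covector h x} u (Set.toFinite _)
        (coversLeft_covector h x i)
    choose t ht htmax using hne
    have hLg : L (col g) = ∑ p ∈ G, u p.2 := by
      rw [hLu, ← Fintype.sum_prod_type' (f := fun i j => g i j * u j)]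
      simp [g, ite_mul, Finset.sum_ite_mem]
    -- Sending the whole mass of row `i` to `t i` gives an admissible flow, whose value is the first
    -- sum in the directional derivative.
    have hft : L (col fun i j => if j = t i then ∑ j, g i j else 0) = ∑ p ∈ G, u (t p.1) := by
      rw [hLu]
      simp only [ite_mul, zero_mul, Finset.sum_ite_eq', Finset.mem_univ, if_true, Finset.sum_mul]
      rw [← Fintype.sum_prod_type' (f := fun i j => g i j * u (t i))]
      simp [g, ite_mul, Finset.sum_ite_mem]
    have hlt : ∑ p ∈ G, u (t p.1) < ∑ p ∈ G, u p.2 := by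
      rw [← hft, ← hLg]
      refine (hL _ ⟨_, ⟨fun i j => ?_, fun i j hij => ?_, fun i => ?_⟩, rfl⟩).trans hs
      · split_ifs
        · exact Finset.sum_nonneg fun j _ => by
            simp only [g]
            split_ifs <;> norm_num
        · exact le_rfl
      · exact if_neg fun he : j = t i => hij (he ▸ ht i)
      · simp
    -- Subtracting the constant `u j₀` keeps the moved point normalized and does not affect the
    -- derivative.
    obtain ⟨ε, hε, hle⟩ := slack_add_le h G x (fun j => u j - u j₀) ht
      (fun i k hik => sub_le_sub_right (htmax i k hik) _)
    have h1 := hmin (x + ε • fun j => u j - u j₀) (by simp [hx])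
    have h2 : ∑ p ∈ G, (u (t p.1) - u j₀ - (u p.2 - u j₀)) < 0 := by
      simp only [sub_sub_sub_cancel_right, Finset.sum_sub_distrib]
      linarith
    have := mul_neg_of_pos_of_neg hε h2
    linarith

/-- At a point of minimal slack, the flow on the covector has the degrees of `G`. Its support and
`G` are both noncrossing, so uniqueness identifies it with the indicator of `G`. -/
theorem IsNoncrossingHeight.exists_subset_covector [Finite I] [Fintype J]
    (hh : IsNoncrossingHeight l h) (hl : ∀ i, Function.Injective (l i))
    (hl' : ∀ j, Function.Injective fun i => l i j) (hG : IsNoncrossing (ArcCross l) G)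
    (hGR : CoversRight G) (j₀ : J) : ∃ x : J → ℝ, x j₀ = 0 ∧ G ⊆ covector h x := by
  classical
  have := Fintype.ofFinite I
  obtain ⟨x, hx, hmin⟩ := exists_min_slack h G.toFinset (by simpa using hGR) j₀
  obtain ⟨f, hf0, hfs, hrow, hcol⟩ := exists_flow_of_min_slack h G.toFinset hx hmin
  refine ⟨x, hx, ?_⟩
  rintro ⟨i, j⟩ hij
  refine hfs i j ?_
  have key := eq_of_isNoncrossing_support hl hl' (f := f)
    (g := fun i j => if (i, j) ∈ G.toFinset then 1 else 0) hf0
    (fun i j => by split_ifs <;> norm_num) hrow hcol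
    (fun p hp q hq => hh.isNoncrossing_covector x p (hfs _ _ hp) q (hfs _ _ hq))
    (fun p hp q hq => hG p (by simpa using hp) q (by simpa using hq)) i j
  simp [key, hij]

/-- Every noncrossing graph without isolated nodes is a covector. -/
theorem IsNoncrossingHeight.exists_covector_eq [Finite I] [Fintype J]
    (hh : IsNoncrossingHeight l h) (hl : ∀ i, Function.Injective (l i))
    (hl' : ∀ j, Function.Injective fun i => l i j) (hG : IsNoncrossing (ArcCross l) G)
    (hGL : CoversLeft G) (hGR : CoversRight G) (j₀ : J) :
    ∃ x : J → ℝ, x j₀ = 0 ∧ covector h x = G := by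
  classical
  obtain ⟨ε, hε, hlt⟩ := exists_eps_of_finite
    (fun q : {q : (I × J) × (I × J) // q.1.1 ≠ q.2.1 ∧ q.1.2 ≠ q.2.2 ∧ ¬ ArcCross l q.1 q.2} =>
      (h q.1.1.1 q.1.2.2 + h q.1.2.1 q.1.1.2) - (h q.1.1.1 q.1.1.2 + h q.1.2.1 q.1.2.2))
    (fun _ => 2) fun ⟨⟨⟨i, j⟩, ⟨i', j'⟩⟩, hi, hj, hc⟩ => sub_pos.2 (hh i i' j j' hi hj hc)
  -- Lowering the heights off `G` by `ε` costs a noncrossing inequality at most `2 * ε`, and it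
  -- forces arcs off `G` to miss the maximum for `h` by at least `ε`.
  let h' : I → J → ℝ := fun i j => if (i, j) ∈ G then h i j else h i j - ε
  have hle : ∀ i j, h' i j ≤ h i j ∧ h i j - ε ≤ h' i j := fun i j => by
    simp only [h']
    split_ifs <;> constructor <;> linarith
  have hh' : IsNoncrossingHeight l h' := fun i i' j j' hi hj hc => by
    have := hlt ⟨((i, j), (i', j')), hi, hj, hc⟩
    have h1 := hle i j
    have h2 := hle i' j'
    have h3 := hle i j'
    have h4 := hle i' j
    simp only at this
    linarith
  obtain ⟨x, hx, hGx⟩ := hh'.exists_subset_covector hl hl' hG hGR j₀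
  refine ⟨x, hx, Set.Subset.antisymm ?_ ?_⟩
  · rintro ⟨i, j⟩ hij
    by_contra hn
    obtain ⟨k, hk⟩ := hGL i
    have h1 := hGx hk j
    have h2 := hij k
    simp only [h', if_neg hn, if_pos hk] at h1 h2
    linarith
  · rintro ⟨i, j⟩ hij k
    have h1 := hGx hij k
    have h2 := hle i k
    simp only [h', if_pos hij] at h1 h2 ⊢
    linarith

end Existence

/-! ### Posets of noncrossing sets, disjoint sums and links. -/

section NoncrossingPosets

/-- The sets of pairwise noncrossing elements, ordered by inclusion. -/
abbrev NoncrossingSets {A : Type*} (r : A → A → Prop) : Type _ := {S : Set A // IsNoncrossing r S}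

/-- The crossing relation on a subtype. -/
abbrev subRel {A : Type*} (r : A → A → Prop) (p : A → Prop) : {a // p a} → {a // p a} → Prop :=
  fun a b => r a.1 b.1

variable {A B : Type*} {r : A → A → Prop} {s : B → B → Prop}

/-- A relation isomorphism induces an isomorphism of the posets of noncrossing sets. -/
def RelIso.noncrossingSets (e : r ≃r s) : NoncrossingSets r ≃o NoncrossingSets s where
  toFun S := ⟨e.symm ⁻¹' S.1, fun p hp q hq hpq => S.2 _ hp _ hq (e.symm.map_rel_iff.2 hpq)⟩
  invFun S := ⟨e ⁻¹' S.1, fun p hp q hq hpq => S.2 _ hp _ hq (e.map_rel_iff.2 hpq)⟩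
  left_inv S := by
    ext a
    simp
  right_inv S := by
    ext a
    simp
  map_rel_iff' {S T} := by
    refine ⟨fun hST a ha => ?_, fun hST a ha => hST ha⟩
    have : e a ∈ e.symm ⁻¹' S.1 := by simpa using ha
    simpa using hST this

/-- The noncrossing sets of a disjoint union without crossings between the two parts. -/
def noncrossingSetsSum (r : A → A → Prop) (s : B → B → Prop) :
    NoncrossingSets (Sum.LiftRel r s) ≃o NoncrossingSets r × NoncrossingSets s where
  toFun S := (⟨Sum.inl ⁻¹' S.1, fun p hp q hq hpq => S.2 _ hp _ hq (Sum.LiftRel.inl hpq)⟩,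
    ⟨Sum.inr ⁻¹' S.1, fun p hp q hq hpq => S.2 _ hp _ hq (Sum.LiftRel.inr hpq)⟩)
  invFun S := ⟨Sum.elim S.1.1 S.2.1, by
    rintro _ hp _ hq (hpq | hpq)
    · exact S.1.2 _ hp _ hq hpq
    · exact S.2.2 _ hp _ hq hpq⟩
  left_inv S := by
    apply Subtype.ext
    ext (a | a) <;> rfl
  right_inv S := rfl
  map_rel_iff' {S T} := by
    refine ⟨fun hST a ha => ?_, fun hST => ⟨fun a ha => hST ha, fun a ha => hST ha⟩⟩
    rcases a with a | a
    · exact hST.1 ha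
    · exact hST.2 ha

/-- The noncrossing sets that contain `S`. -/
abbrev NoncrossingAbove {A : Type*} (r : A → A → Prop) (S : Set A) : Type _ :=
  {T : Set A // S ⊆ T ∧ IsNoncrossing r T}

/-- The noncrossing sets that contain `S` are the noncrossing sets of the link of `S`. -/
def noncrossingAboveIso {S : Set A} (hS : IsNoncrossing r S) (hr : ∀ a b, r a b → r b a) :
    NoncrossingAbove r S ≃o NoncrossingSets (subRel r fun a => a ∉ S ∧ ∀ s ∈ S, ¬ r a s) where
  toFun T := ⟨{a | a.1 ∈ T.1}, fun p hp q hq => T.2.2 _ hp _ hq⟩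
  invFun T := ⟨S ∪ Subtype.val '' T.1, Set.subset_union_left, by
    rintro p (hp | ⟨p, hp, rfl⟩) q (hq | ⟨q, hq, rfl⟩) hpq
    · exact hS p hp q hq hpq
    · exact q.2.2 p hp (hr _ _ hpq)
    · exact p.2.2 q hq hpq
    · exact T.2 p hp q hq hpq⟩
  left_inv T := by
    apply Subtype.ext
    ext a
    constructor
    · rintro (ha | ⟨a, ha, rfl⟩)
      · exact T.2.1 ha
      · exact ha
    · intro ha
      by_cases haS : a ∈ S
      · exact Or.inl haS
      · exact Or.inr ⟨⟨a, haS, fun s hs => T.2.2 a ha s (T.2.1 hs)⟩, ha, rfl⟩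
  right_inv T := by
    apply Subtype.ext
    ext a
    constructor
    · rintro (ha | ⟨b, hb, hba⟩)
      · exact absurd ha a.2.1
      · rwa [← Subtype.ext hba]
    · intro ha
      exact Or.inr ⟨a, ha, rfl⟩
  map_rel_iff' {T T'} := by
    refine ⟨fun hTT a ha => ?_, fun hTT a ha => hTT ha⟩
    by_cases haS : a ∈ S
    · exact T'.2.1 haS
    · exact hTT (show (⟨a, haS, fun s hs => T.2.2 a ha s (T.2.1 hs)⟩ :
        {a // a ∉ S ∧ ∀ s ∈ S, ¬ r a s}) ∈ _ from ha)

end NoncrossingPosets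

/-! ### The polygon model, the cyclic model, and the links of their elements. -/

section ArcModels

/-- The diagonals of the `(d + 3)`-gon. -/
abbrev IsLinArc (d : ℕ) (p : ℕ × ℕ) : Prop :=
  p.1 + 1 < p.2 ∧ p.2 ≤ d + 2 ∧ ¬ (p.1 = 0 ∧ p.2 = d + 2)

/-- Two diagonals cross. -/
abbrev linRel (p q : ℕ × ℕ) : Prop :=
  (p.1 < q.1 ∧ q.1 < p.2 ∧ p.2 < q.2) ∨ (q.1 < p.1 ∧ p.1 < q.2 ∧ q.2 < p.2)

/-- The crossing relation on the diagonals of the `(d + 3)`-gon. -/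
abbrev linCross (d : ℕ) : {p // IsLinArc d p} → {p // IsLinArc d p} → Prop :=
  subRel linRel (IsLinArc d)

/-- The arcs `(i, j̄)` with `i ≠ j` in `{0, …, n}`. -/
abbrev IsCycArc (n : ℕ) (p : ℕ × ℕ) : Prop := p.1 ≤ n ∧ p.2 ≤ n ∧ p.1 ≠ p.2

/-- Two arcs cyclically cross. -/
abbrev cycRel (n : ℕ) (p q : ℕ × ℕ) : Prop := CyclicallyCross n p.1 p.2 q.1 q.2

/-- The crossing relation on the arcs `(i, j̄)` with `i ≠ j`. -/
abbrev cycCross (n : ℕ) : {p // IsCycArc n p} → {p // IsCycArc n p} → Prop :=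
  subRel (cycRel n) (IsCycArc n)

theorem arcLength_eq_ite {n i j : ℕ} (hi : i ≤ n) (hj : j ≤ n) :
    arcLength n i j = if i ≤ j then (j : ℤ) - i else (j : ℤ) - i + (n + 1) := by
  unfold arcLength
  split_ifs with hij
  · exact Int.emod_eq_of_lt (by omega) (by omega)
  · rw [← Int.add_emod_right]
    exact Int.emod_eq_of_lt (by omega) (by omega)

/-- The condition says that `i'` lies in the cyclic interval from `i` (excluded) to `j` (included).
Written with linear inequalities, it makes crossing questions decidable by `omega`. -/
theorem arcLength_lt_left_iff {n i i' j : ℕ} (hi : i ≤ n) (hi' : i' ≤ n) (hj : j ≤ n) :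
    arcLength n i' j < arcLength n i j ↔ (i < i' ∧ i' ≤ j) ∨ (i' ≤ j ∧ j < i) ∨ (j < i ∧ i < i') := by
  rw [arcLength_eq_ite hi' hj, arcLength_eq_ite hi hj]
  split_ifs <;> omega

theorem arcLength_lt_right_iff {n i j j' : ℕ} (hi : i ≤ n) (hj : j ≤ n) (hj' : j' ≤ n) :
    arcLength n i j < arcLength n i j' ↔
      (i ≤ j ∧ j < j') ∨ (j' < i ∧ i ≤ j) ∨ (j < j' ∧ j' < i) := by
  rw [arcLength_eq_ite hi hj, arcLength_eq_ite hi hj']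
  split_ifs <;> omega

theorem cyclicallyCross_iff {n i j i' j' : ℕ} (hi : i ≤ n) (hj : j ≤ n) (hi' : i' ≤ n)
    (hj' : j' ≤ n) : CyclicallyCross n i j i' j' ↔
      (((i < i' ∧ i' ≤ j) ∨ (i' ≤ j ∧ j < i) ∨ (j < i ∧ i < i')) ∧
        ((i' ≤ j ∧ j < j') ∨ (j' < i' ∧ i' ≤ j) ∨ (j < j' ∧ j' < i'))) ∨
      (((i ≤ j' ∧ j' < j) ∨ (j < i ∧ i ≤ j') ∨ (j' < j ∧ j < i)) ∧
        ((i' < i ∧ i ≤ j') ∨ (i ≤ j' ∧ j' < i') ∨ (j' < i' ∧ i' < i))) := by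
  rw [CyclicallyCross, arcLength_lt_left_iff hi hi' hj, arcLength_lt_right_iff hi' hj hj',
    arcLength_lt_right_iff hi hj' hj, arcLength_lt_left_iff hi' hi hj']

theorem cyclicallyCross_iff_of_le {n i j i' j' : ℕ} (hij : i ≤ j) (hj : j ≤ n) (hij' : i' ≤ j')
    (hj' : j' ≤ n) : CyclicallyCross n i j i' j' ↔
      (i < i' ∧ i' ≤ j ∧ j < j') ∨ (i' < i ∧ i ≤ j' ∧ j' < j) := by
  rw [cyclicallyCross_iff (hij.trans hj) hj (hij'.trans hj') hj']
  omega

/-- Crossing depends only on the relative order of the endpoints, so they may be relabelled by ranks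
and `n` may be changed. -/
theorem cyclicallyCross_congr {n n' i j i' j' a b a' b' : ℕ}
    (hi : i ≤ n) (hj : j ≤ n) (hi' : i' ≤ n) (hj' : j' ≤ n)
    (ha : a ≤ n') (hb : b ≤ n') (ha' : a' ≤ n') (hb' : b' ≤ n')
    (haa : a < a' ↔ i < i') (haa' : a' < a ↔ i' < i) (hbb : b < b' ↔ j < j')
    (hbb' : b' < b ↔ j' < j) (hab : a ≤ b ↔ i ≤ j) (hab' : a ≤ b' ↔ i ≤ j')
    (hba : a' ≤ b ↔ i' ≤ j) (hba' : a' ≤ b' ↔ i' ≤ j') :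
    CyclicallyCross n' a b a' b' ↔ CyclicallyCross n i j i' j' := by
  rw [cyclicallyCross_iff ha hb ha' hb', cyclicallyCross_iff hi hj hi' hj', haa, haa', hbb, hbb',
    hab', hba, ← not_le (a := a), ← not_le (a := a'), hab, hba', not_le, not_le]

theorem CyclicallyCross.symm {n i j i' j' : ℕ} (hc : CyclicallyCross n i j i' j') :
    CyclicallyCross n i' j' i j :=
  (Or.symm hc).imp And.symm And.symm

theorem linRel_symm {p q : ℕ × ℕ} (hc : linRel p q) : linRel q p := Or.symm hc

/-- The condition on an element to lie in the link of `e`. -/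
abbrev InLink {A : Type*} (r : A → A → Prop) (e a : A) : Prop := a ≠ e ∧ ¬ r a e

/-- A template for splitting a link: `T` separates the two pieces, and explicit inverse maps reduce
each application to arithmetic. -/
theorem nonempty_relIso_sum {A B C : Type*} {R₁ : A → A → Prop} {R₂ : B → B → Prop}
    {R : C → C → Prop} {P₁ : A → Prop} {P₂ : B → Prop} {P : C → Prop} {e : {c // P c}}
    (T : C → Prop) (f₁ : A → C) (f₂ : B → C) (g₁ : C → A) (g₂ : C → B)
    (hf₁ : ∀ p, P₁ p → (P (f₁ p) ∧ InLink R e.1 (f₁ p)) ∧ T (f₁ p) ∧ g₁ (f₁ p) = p)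
    (hf₂ : ∀ p, P₂ p → (P (f₂ p) ∧ InLink R e.1 (f₂ p)) ∧ ¬ T (f₂ p) ∧ g₂ (f₂ p) = p)
    (hg₁ : ∀ p, P p → InLink R e.1 p → T p → P₁ (g₁ p) ∧ f₁ (g₁ p) = p)
    (hg₂ : ∀ p, P p → InLink R e.1 p → ¬ T p → P₂ (g₂ p) ∧ f₂ (g₂ p) = p)
    (h₁ : ∀ p q, P₁ p → P₁ q → (R (f₁ p) (f₁ q) ↔ R₁ p q))
    (h₂ : ∀ p q, P₂ p → P₂ q → (R (f₂ p) (f₂ q) ↔ R₂ p q))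
    (h₁₂ : ∀ p q, P₁ p → P₂ q → ¬ R (f₁ p) (f₂ q)) (hR : ∀ p q, R p q → R q p) :
    Nonempty (Sum.LiftRel (subRel R₁ P₁) (subRel R₂ P₂) ≃r
      subRel (subRel R P) (InLink (subRel R P) e)) := by
  have hlink : ∀ p (hp : P p), InLink R e.1 p → InLink (subRel R P) e ⟨p, hp⟩ := fun p hp hl =>
    ⟨fun he => hl.1 (congrArg Subtype.val he), hl.2⟩
  have hlink' : ∀ p : {c // P c}, InLink (subRel R P) e p → InLink R e.1 p.1 := fun p hl =>
    ⟨fun he => hl.1 (Subtype.ext he), hl.2⟩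
  let φ : {p // P₁ p} ⊕ {p // P₂ p} → {c // InLink (subRel R P) e c} :=
    Sum.elim (fun p => ⟨⟨f₁ p.1, (hf₁ _ p.2).1.1⟩, hlink _ _ (hf₁ _ p.2).1.2⟩)
      fun p => ⟨⟨f₂ p.1, (hf₂ _ p.2).1.1⟩, hlink _ _ (hf₂ _ p.2).1.2⟩
  refine ⟨⟨Equiv.ofBijective φ ⟨?_, ?_⟩, ?_⟩⟩
  · rintro (⟨p, hp⟩ | ⟨p, hp⟩) (⟨q, hq⟩ | ⟨q, hq⟩) hpq
    · have he : f₁ p = f₁ q := congrArg (fun z => z.1.1) hpq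
      have he' : p = q := by rw [← (hf₁ p hp).2.2, he, (hf₁ q hq).2.2]
      subst he'
      rfl
    · have he : f₁ p = f₂ q := congrArg (fun z => z.1.1) hpq
      exact absurd (he ▸ (hf₁ p hp).2.1) (hf₂ q hq).2.1
    · have he : f₂ p = f₁ q := congrArg (fun z => z.1.1) hpq
      exact absurd (he ▸ (hf₁ q hq).2.1) (hf₂ p hp).2.1
    · have he : f₂ p = f₂ q := congrArg (fun z => z.1.1) hpq
      have he' : p = q := by rw [← (hf₂ p hp).2.2, he, (hf₂ q hq).2.2]
      subst he'
      rfl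
  · rintro ⟨⟨p, hp⟩, hl⟩
    by_cases hT : T p
    · have := hg₁ p hp (hlink' _ hl) hT
      exact ⟨Sum.inl ⟨g₁ p, this.1⟩, Subtype.ext (Subtype.ext this.2)⟩
    · have := hg₂ p hp (hlink' _ hl) hT
      exact ⟨Sum.inr ⟨g₂ p, this.1⟩, Subtype.ext (Subtype.ext this.2)⟩
  · rintro (⟨p, hp⟩ | ⟨p, hp⟩) (⟨q, hq⟩ | ⟨q, hq⟩)
    · rw [Sum.liftRel_inl_inl]
      exact h₁ p q hp hq
    · exact iff_of_false (h₁₂ p q hp hq) Sum.not_liftRel_inl_inr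
    · exact iff_of_false (fun hc => h₁₂ q p hq hp (hR _ _ hc)) Sum.not_liftRel_inr_inl
    · rw [Sum.liftRel_inr_inr]
      exact h₂ p q hp hq

/-- The link of a diagonal of a polygon consists of the diagonals of the two polygons into which it
cuts the polygon. -/
theorem nonempty_relIso_link_linCross {d : ℕ} (e : {p // IsLinArc d p}) : ∃ d₁ d₂ : ℕ,
    Nonempty (Sum.LiftRel (linCross d₁) (linCross d₂) ≃r
      subRel (linCross d) (InLink (linCross d) e)) := by
  obtain ⟨⟨p, w⟩, h1, h2, h3⟩ := e
  simp only at h1 h2 h3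
  -- The diagonal cuts off the (c + 3)-gon on the vertices from `p` to `p + c + 2`. Removing the c +
  -- 1 vertices strictly between its ends leaves a (b + 3)-gon.
  obtain ⟨c, rfl⟩ : ∃ c, w = p + c + 2 := ⟨w - p - 2, by omega⟩
  obtain ⟨b, rfl⟩ : ∃ b, d = b + c + 1 := ⟨d - c - 1, by omega⟩
  refine ⟨c, b, nonempty_relIso_sum (fun x => p ≤ x.1 ∧ x.2 ≤ p + c + 2)
    (fun x => (x.1 + p, x.2 + p))
    (fun x => (if x.1 ≤ p then x.1 else x.1 + (c + 1), if x.2 ≤ p then x.2 else x.2 + (c + 1)))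
    (fun x => (x.1 - p, x.2 - p))
    (fun x => (if x.1 ≤ p then x.1 else x.1 - (c + 1), if x.2 ≤ p then x.2 else x.2 - (c + 1)))
    ?_ ?_ ?_ ?_ ?_ ?_ ?_ fun _ _ => linRel_symm⟩
  · rintro ⟨x, y⟩ hx
    simp only [InLink, IsLinArc, linRel, ne_eq, Prod.mk.injEq] at *
    omega
  · rintro ⟨x, y⟩ hx
    simp only [InLink, IsLinArc, linRel, ne_eq, Prod.mk.injEq] at *
    split_ifs <;> (try simp only [false_and, true_and, not_false_eq_true, and_true]) <;> omega
  · rintro ⟨x, y⟩ hx hl hT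
    simp only [InLink, IsLinArc, linRel, ne_eq, Prod.mk.injEq] at *
    omega
  · rintro ⟨x, y⟩ hx hl hT
    simp only [InLink, IsLinArc, linRel, ne_eq, Prod.mk.injEq] at *
    split_ifs <;> omega
  · rintro ⟨x, y⟩ ⟨x', y'⟩ hx hx'
    simp only [IsLinArc, linRel] at *
    omega
  · rintro ⟨x, y⟩ ⟨x', y'⟩ hx hx'
    simp only [IsLinArc, linRel] at *
    split_ifs <;> omega
  · rintro ⟨x, y⟩ ⟨x', y'⟩ hx hx'
    simp only [IsLinArc, linRel] at *
    split_ifs <;> omega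

/-- The position of `u` relative to `p` in the cyclic order on `{0, …, n}`. -/
def cycSub (n p u : ℕ) : ℕ := if p ≤ u then u - p else u + (n + 1) - p

/-- The element of `{0, …, n}` at the position `u` relative to `p`. -/
def cycAdd (n p u : ℕ) : ℕ := if p + u ≤ n then p + u else p + u - (n + 1)

theorem arcLength_cycSub {n p u v : ℕ} (hp : p ≤ n) (hu : u ≤ n) (hv : v ≤ n) :
    arcLength n (cycSub n p u) (cycSub n p v) = arcLength n u v := by
  have h1 : cycSub n p u ≤ n := by unfold cycSub; split_ifs <;> omega
  have h2 : cycSub n p v ≤ n := by unfold cycSub; split_ifs <;> omega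
  rw [arcLength_eq_ite h1 h2, arcLength_eq_ite hu hv]
  unfold cycSub
  split_ifs <;> omega

/-- Rotation of the arcs. -/
def cycRotate (n p : ℕ) (hp : p ≤ n) : cycCross n ≃r cycCross n where
  toFun a := ⟨(cycSub n p a.1.1, cycSub n p a.1.2), by
    obtain ⟨⟨x, y⟩, hx⟩ := a
    simp only [cycSub, IsCycArc] at *
    split_ifs <;> omega⟩
  invFun a := ⟨(cycAdd n p a.1.1, cycAdd n p a.1.2), by
    obtain ⟨⟨x, y⟩, hx⟩ := a
    simp only [cycAdd, IsCycArc] at *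
    split_ifs <;> omega⟩
  left_inv a := by
    obtain ⟨⟨x, y⟩, hx⟩ := a
    simp only [cycAdd, cycSub, IsCycArc, Subtype.mk.injEq, Prod.mk.injEq] at *
    constructor <;> split_ifs <;> omega
  right_inv a := by
    obtain ⟨⟨x, y⟩, hx⟩ := a
    simp only [cycAdd, cycSub, IsCycArc, Subtype.mk.injEq, Prod.mk.injEq] at *
    constructor <;> split_ifs <;> omega
  map_rel_iff' {a b} := by
    obtain ⟨⟨x, y⟩, hx, hy, hxy⟩ := a
    obtain ⟨⟨x', y'⟩, hx', hy', hxy'⟩ := b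
    change CyclicallyCross n (cycSub n p x) (cycSub n p y) (cycSub n p x') (cycSub n p y') ↔
      CyclicallyCross n x y x' y'
    unfold CyclicallyCross
    rw [arcLength_cycSub hp hx hy, arcLength_cycSub hp hx' hy', arcLength_cycSub hp hx' hy,
      arcLength_cycSub hp hx hy']

/-- An isomorphism restricts to the links of corresponding elements. -/
def RelIso.link {A B : Type*} {r : A → A → Prop} {s : B → B → Prop} (f : r ≃r s) (e : A) :
    subRel r (InLink r e) ≃r subRel s (InLink s (f e)) where
  toEquiv := f.toEquiv.subtypeEquiv fun a => by
    change _ ∧ _ ↔ f a ≠ f e ∧ ¬ s (f a) (f e)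
    rw [f.map_rel_iff, f.injective.ne_iff]
  map_rel_iff' := f.map_rel_iff

/-- Arcs inside the interval from 0 to `q` become diagonals of a (q + 2)-gon when right ends are
moved up by one. For the other arcs the interval contracts to one element, whose left copy is 0 and
whose right copy is `q`. Arcs that start and end in the interval but wrap around cross (0, q). -/
theorem nonempty_relIso_link_cycCross_zero {n q : ℕ} (hq0 : 0 < q) (hq : q ≤ n)
    (hq' : IsCycArc n (0, q)) :
    Nonempty (Sum.LiftRel (linCross (q - 1)) (cycCross (n - q)) ≃r
      subRel (cycCross n) (InLink (cycCross n) ⟨(0, q), hq'⟩)) := by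
  obtain ⟨d, rfl⟩ : ∃ d, q = d + 1 := ⟨q - 1, by omega⟩
  obtain ⟨b, rfl⟩ : ∃ b, n = d + 1 + b := ⟨n - d - 1, by omega⟩
  rw [show d + 1 - 1 = d by omega, show d + 1 + b - (d + 1) = b by omega]
  refine nonempty_relIso_sum (fun x => x.1 ≤ d + 1 ∧ x.2 ≤ d + 1)
    (fun x => (x.1, x.2 - 1))
    (fun x => (if x.1 = 0 then 0 else x.1 + (d + 1), x.2 + (d + 1)))
    (fun x => (x.1, x.2 + 1))
    (fun x => (if x.1 = 0 then 0 else x.1 - (d + 1), x.2 - (d + 1)))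
    ?_ ?_ ?_ ?_ ?_ ?_ ?_ fun _ _ => CyclicallyCross.symm
  · rintro ⟨x, y⟩ hx
    simp only [InLink, IsLinArc, IsCycArc, cycRel, ne_eq, Prod.mk.injEq, true_and] at *
    rw [cyclicallyCross_iff_of_le] <;> omega
  · rintro ⟨x, y⟩ hx
    simp only [InLink, IsCycArc, cycRel, ne_eq, Prod.mk.injEq] at *
    rw [cyclicallyCross_iff] <;> (try split_ifs) <;> (try simp only [false_and, true_and, not_false_eq_true, and_true] at *) <;> omega
  · rintro ⟨x, y⟩ hx hl hT
    simp only [InLink, IsLinArc, IsCycArc, cycRel, ne_eq, Prod.mk.injEq, true_and] at *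
    rw [cyclicallyCross_iff] at hl <;> omega
  · rintro ⟨x, y⟩ hx hl hT
    simp only [InLink, IsCycArc, cycRel, ne_eq, Prod.mk.injEq] at *
    rw [cyclicallyCross_iff] at hl <;> (try split_ifs) <;> (try contradiction) <;> omega
  · rintro ⟨x, y⟩ ⟨x', y'⟩ hx hx'
    simp only [IsLinArc, IsCycArc, linRel, cycRel] at *
    rw [cyclicallyCross_iff_of_le] <;> omega
  · rintro ⟨x, y⟩ ⟨x', y'⟩ hx hx'
    simp only [IsCycArc, cycRel] at *
    apply cyclicallyCross_congr <;> (try split_ifs) <;> omega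
  · rintro ⟨x, y⟩ ⟨x', y'⟩ hx hx'
    simp only [IsLinArc, IsCycArc, cycRel] at *
    rw [cyclicallyCross_iff] <;> (try split_ifs) <;> omega

/-- The link of an arc in the cyclic model splits off the diagonals of a polygon. -/
theorem nonempty_relIso_link_cycCross {n : ℕ} (e : {p // IsCycArc n p}) : ∃ d b : ℕ,
    Nonempty (Sum.LiftRel (linCross d) (cycCross b) ≃r
      subRel (cycCross n) (InLink (cycCross n) e)) := by
  have h0 : cycSub n e.1.1 e.1.1 = 0 := by simp [cycSub]
  have hm := (cycRotate n e.1.1 e.2.1 e).2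
  have he : cycRotate n e.1.1 e.2.1 e = ⟨(0, (cycRotate n e.1.1 e.2.1 e).1.2), h0 ▸ hm⟩ :=
    Subtype.ext (Prod.ext h0 rfl)
  have hne : (cycRotate n e.1.1 e.2.1 e).1.2 ≠ 0 := fun hz => hm.2.2 (h0.trans hz.symm)
  obtain ⟨f⟩ := nonempty_relIso_link_cycCross_zero (Nat.pos_of_ne_zero hne) hm.2.1 (h0 ▸ hm)
  refine ⟨_, _, ⟨f.trans ?_⟩⟩
  rw [← he]
  exact ((cycRotate n e.1.1 e.2.1).link e).symm

end ArcModels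

/-! ### Arcs as half-turn orbits of chords of the (2n + 2)-gon. -/

section Dissections

/-- The end in the `(2n + 2)`-gon of the chord from the vertex `p.1` that represents the arc `p`. -/
def chordEnd (n : ℕ) (p : ℕ × ℕ) : ℕ := if p.1 < p.2 then p.2 + 1 else p.2 + n + 2

/-- An arc of length ℓ from i is drawn as the chord from vertex i to vertex i + ℓ + 1; since ℓ runs
from 1 to n, these are diagonals up to and including the diameter. -/
theorem chordEnd_spec {n : ℕ} {p : ℕ × ℕ} (hp : IsCycArc n p) :
    p.1 + 2 ≤ chordEnd n p ∧ chordEnd n p ≤ p.1 + n + 1 ∧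
    ((p.1 < p.2 ∧ chordEnd n p = p.2 + 1) ∨ (p.2 < p.1 ∧ chordEnd n p = p.2 + n + 2)) := by
  obtain ⟨i, j⟩ := p
  simp only [IsCycArc, chordEnd] at *
  split_ifs <;> omega

/-- The chord of the `(2n + 2)`-gon from `a` to `b` represents the arc `p`. -/
def IsChord (n : ℕ) (p : ℕ × ℕ) (a b : ℕ) : Prop :=
  (a = p.1 ∧ b = chordEnd n p) ∨ (a = p.1 + n + 1 ∧ b = chordEnd n p + n + 1 ∧ chordEnd n p ≤ n) ∨
    (a = p.1 + n + 1 ∧ b + n + 1 = chordEnd n p)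

theorem IsChord.unique {n : ℕ} {p q : ℕ × ℕ} (hp : IsCycArc n p) (hq : IsCycArc n q) {a b : ℕ}
    (h1 : IsChord n p a b ∨ IsChord n p b a) (h2 : IsChord n q a b ∨ IsChord n q b a) : p = q := by
  have e1 := chordEnd_spec hp
  have e2 := chordEnd_spec hq
  obtain ⟨i, j⟩ := p
  obtain ⟨i', j'⟩ := q
  simp only [IsCycArc, IsChord, Prod.mk.injEq] at *
  omega

theorem exists_isChord {n a b : ℕ} (hab : a + 1 < b) (hb : b ≤ 2 * n + 1)
    (h0 : ¬ (a = 0 ∧ b = 2 * n + 1)) :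
    ∃ p, IsCycArc n p ∧ (IsChord n p a b ∨ IsChord n p b a) := by
  have key : ∀ i j, IsCycArc n (i, j) →
      (IsCycArc n (i, j) → (IsChord n (i, j) a b ∨ IsChord n (i, j) b a)) →
      ∃ p, IsCycArc n p ∧ (IsChord n p a b ∨ IsChord n p b a) := fun i j hp h => ⟨_, hp, h hp⟩
  by_cases h1 : b ≤ a + n + 1
  · by_cases h2 : a ≤ n
    · by_cases h3 : b ≤ n + 1
      · refine key a (b - 1) (by simp only [IsCycArc]; omega) fun hp => ?_
        have := chordEnd_spec hp
        simp only [IsChord, true_and] at *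
        omega
      · refine key a (b - (n + 2)) (by simp only [IsCycArc]; omega) fun hp => ?_
        have := chordEnd_spec hp
        simp only [IsChord, true_and] at *
        omega
    · refine key (a - (n + 1)) (b - (n + 2)) (by simp only [IsCycArc]; omega) fun hp => ?_
      have := chordEnd_spec hp
      simp only [IsChord] at *
      omega
  · by_cases h2 : a = 0
    · refine key (b - (n + 1)) n (by simp only [IsCycArc]; omega) fun hp => ?_
      have := chordEnd_spec hp
      simp only [IsChord] at *
      omega
    · refine key (b - (n + 1)) (a - 1) (by simp only [IsCycArc]; omega) fun hp => ?_
      have := chordEnd_spec hp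
      simp only [IsChord] at *
      omega

theorem IsChord.bounds {n : ℕ} {p : ℕ × ℕ} (hp : IsCycArc n p) {a b : ℕ}
    (h1 : IsChord n p a b ∨ IsChord n p b a) (hab : a < b) :
    a + 1 < b ∧ b ≤ 2 * n + 1 ∧ ¬ (a = 0 ∧ b = 2 * n + 1) := by
  have e1 := chordEnd_spec hp
  obtain ⟨i, j⟩ := p
  simp only [IsCycArc, IsChord] at *
  omega

theorem cyclicallyCross_of_isChord {n : ℕ} {p q : ℕ × ℕ} (hp : IsCycArc n p) (hq : IsCycArc n q)
    {a b c d : ℕ} (h1 : IsChord n p a b ∨ IsChord n p b a) (h2 : IsChord n q c d ∨ IsChord n q d c)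
    (hac : a < c) (hcb : c < b) (hbd : b < d) : cycRel n p q := by
  have e1 := chordEnd_spec hp
  have e2 := chordEnd_spec hq
  obtain ⟨i, j⟩ := p
  obtain ⟨i', j'⟩ := q
  rw [cycRel, cyclicallyCross_iff hp.1 hp.2.1 hq.1 hq.2.1]
  simp only [IsCycArc, IsChord] at *
  obtain ⟨-, -, e1 | e1⟩ := e1 <;> obtain ⟨-, -, e2 | e2⟩ := e2 <;>
  rcases h1 with (h1 | h1 | h1) | (h1 | h1 | h1) <;>
  rcases h2 with (h2 | h2 | h2) | (h2 | h2 | h2) <;> omega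

/-- For each arc it suffices to test the chord starting at its left node and the half-turn image of
that chord, with ends in increasing order; one of the four resulting pairs crosses. -/
theorem exists_isChord_of_cyclicallyCross {n : ℕ} {p q : ℕ × ℕ} (hp : IsCycArc n p)
    (hq : IsCycArc n q) (hc : cycRel n p q)
    (hno : ∀ a b c d, (IsChord n p a b ∨ IsChord n p b a) → (IsChord n q c d ∨ IsChord n q d c) →
      ¬ (a < c ∧ c < b ∧ b < d) ∧ ¬ (c < a ∧ a < d ∧ d < b)) : False := by
  have e1 := chordEnd_spec hp
  have e2 := chordEnd_spec hq
  obtain ⟨i, j⟩ := p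
  obtain ⟨i', j'⟩ := q
  rw [cycRel, cyclicallyCross_iff hp.1 hp.2.1 hq.1 hq.2.1] at hc
  have hP : ∃ a b, a < b ∧ (IsChord n (i, j) a b ∨ IsChord n (i, j) b a) ∧
      ((a = i + n + 1 ∧ b = chordEnd n (i, j) + n + 1 ∧ chordEnd n (i, j) ≤ n) ∨
      (b = i + n + 1 ∧ a + n + 1 = chordEnd n (i, j))) := by
    simp only [IsCycArc] at hp
    by_cases he : chordEnd n (i, j) ≤ n
    · exact ⟨i + n + 1, chordEnd n (i, j) + n + 1, by omega,
        Or.inl (Or.inr (Or.inl ⟨rfl, rfl, he⟩)), Or.inl ⟨rfl, rfl, he⟩⟩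
    · exact ⟨chordEnd n (i, j) - (n + 1), i + n + 1, by simp only at e1; omega,
        Or.inr (Or.inr (Or.inr ⟨rfl, by omega⟩)), Or.inr ⟨rfl, by omega⟩⟩
  have hQ : ∃ a b, a < b ∧ (IsChord n (i', j') a b ∨ IsChord n (i', j') b a) ∧
      ((a = i' + n + 1 ∧ b = chordEnd n (i', j') + n + 1 ∧ chordEnd n (i', j') ≤ n) ∨
      (b = i' + n + 1 ∧ a + n + 1 = chordEnd n (i', j'))) := by
    simp only [IsCycArc] at hq
    by_cases he : chordEnd n (i', j') ≤ n
    · exact ⟨i' + n + 1, chordEnd n (i', j') + n + 1, by omega,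
        Or.inl (Or.inr (Or.inl ⟨rfl, rfl, he⟩)), Or.inl ⟨rfl, rfl, he⟩⟩
    · exact ⟨chordEnd n (i', j') - (n + 1), i' + n + 1, by simp only at e2; omega,
        Or.inr (Or.inr (Or.inr ⟨rfl, by omega⟩)), Or.inr ⟨rfl, by omega⟩⟩
  obtain ⟨a, b, hab, hPab, hP'⟩ := hP
  obtain ⟨c, d, hcd, hQcd, hQ'⟩ := hQ
  have hP0 : IsChord n (i, j) i (chordEnd n (i, j)) := Or.inl ⟨rfl, rfl⟩
  have hQ0 : IsChord n (i', j') i' (chordEnd n (i', j')) := Or.inl ⟨rfl, rfl⟩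
  have n1 := hno _ _ _ _ (Or.inl hP0) (Or.inl hQ0)
  have n2 := hno _ _ _ _ hPab (Or.inl hQ0)
  have n3 := hno _ _ _ _ (Or.inl hP0) hQcd
  have n4 := hno _ _ _ _ hPab hQcd
  clear hno hP0 hQ0 hPab hQcd
  generalize chordEnd n (i, j) = E at *
  generalize chordEnd n (i', j') = E' at *
  simp only [IsCycArc] at *
  obtain ⟨-, -, e1 | e1⟩ := e1 <;> obtain ⟨-, -, e2 | e2⟩ := e2 <;>
  rcases hP' with hP' | hP' <;> rcases hQ' with hQ' | hQ' <;>
  rcases hc with ⟨hc | hc | hc, hc' | hc' | hc'⟩ | ⟨hc | hc | hc, hc' | hc' | hc'⟩ <;> omega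

end Dissections

/-! ### Noncrossing sets as dissections. -/

section DissectionPosets

theorem fin_add_half_val {n : ℕ} (a : Fin (2 * n + 2)) :
    (a + ⟨n + 1, by omega⟩ : Fin (2 * n + 2)).val = if a.val ≤ n then a.val + n + 1 else a.val - (n + 1) := by
  rw [Fin.val_add]
  have := a.isLt
  split_ifs with h
  · exact Nat.mod_eq_of_lt (by simp only; omega)
  · simp only
    rw [Nat.mod_eq_sub_mod (by omega), Nat.mod_eq_of_lt (by omega)]
    omega

theorem adj_of_isChord {n : ℕ} {D : SimpleGraph (Fin (2 * n + 2))}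
    (hD : ∀ a b, D.Adj a b → D.Adj (a + ⟨n + 1, by omega⟩) (b + ⟨n + 1, by omega⟩))
    {p : ℕ × ℕ} (hp : IsCycArc n p) {a b a' b' : Fin (2 * n + 2)}
    (h1 : IsChord n p a b ∨ IsChord n p b a) (h2 : IsChord n p a' b' ∨ IsChord n p b' a')
    (hab : D.Adj a b) : D.Adj a' b' := by
  have e1 := chordEnd_spec hp
  have ha := fin_add_half_val a
  have hb := fin_add_half_val b
  have hab' := hD a b hab
  -- Two chords of the same arc agree up to orientation and the half-turn.
  have key : (a' = a ∧ b' = b) ∨ (a' = b ∧ b' = a) ∨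
      (a' = a + ⟨n + 1, by omega⟩ ∧ b' = b + ⟨n + 1, by omega⟩) ∨
      (a' = b + ⟨n + 1, by omega⟩ ∧ b' = a + ⟨n + 1, by omega⟩) := by
    simp only [Fin.ext_iff, ha, hb]
    obtain ⟨i, j⟩ := p
    simp only [IsCycArc, IsChord] at *
    split_ifs <;> rcases h1 with (h1 | h1 | h1) | (h1 | h1 | h1) <;>
    rcases h2 with (h2 | h2 | h2) | (h2 | h2 | h2) <;> omega
  rcases key with ⟨rfl, rfl⟩ | ⟨rfl, rfl⟩ | ⟨rfl, rfl⟩ | ⟨rfl, rfl⟩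
  exacts [hab, hab.symm, hab', hab'.symm]

/-- The graph on the vertices of the `(2n + 2)`-gon of a set of arcs. -/
def chordGraph {n : ℕ} (S : Set {p // IsCycArc n p}) : SimpleGraph (Fin (2 * n + 2)) where
  Adj a b := ∃ p ∈ S, IsChord n p.1 a b ∨ IsChord n p.1 b a
  symm := ⟨fun _ _ ⟨p, hp, h⟩ => ⟨p, hp, h.symm⟩⟩
  loopless := ⟨fun a ⟨p, _, h⟩ => by
    have := chordEnd_spec p.2
    simp only [IsChord] at h
    omega⟩

theorem isDissection_chordGraph {n : ℕ} {S : Set {p // IsCycArc n p}}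
    (hS : IsNoncrossing (cycCross n) S) : IsDissection (chordGraph S) where
  diagonal := by
    rintro a b ⟨p, -, hp⟩ hab
    have := IsChord.bounds p.2 hp hab
    omega
  noncrossing := by
    rintro a b c d ⟨p, hpS, hp⟩ ⟨q, hqS, hq⟩ ⟨hac, hcb, hbd⟩
    exact hS p hpS q hqS (cyclicallyCross_of_isChord p.2 q.2 hp hq hac hcb hbd)

theorem chordGraph_symm {n : ℕ} (S : Set {p // IsCycArc n p}) (a b : Fin (2 * n + 2))
    (hab : (chordGraph S).Adj a b) :
    (chordGraph S).Adj (a + ⟨n + 1, by omega⟩) (b + ⟨n + 1, by omega⟩) := by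
  obtain ⟨p, hpS, hp⟩ := hab
  refine ⟨p, hpS, ?_⟩
  obtain ⟨⟨i, j⟩, hp'⟩ := p
  have e1 := chordEnd_spec hp'
  have := a.isLt
  have := b.isLt
  rw [fin_add_half_val, fin_add_half_val]
  clear hpS
  simp only [IsChord] at *
  rcases hp with (h | h | h) | (h | h | h) <;> split_ifs <;> omega

/-- The arcs whose chord is an edge of the graph. -/
def chordSet {n : ℕ} (D : SimpleGraph (Fin (2 * n + 2))) : Set {p // IsCycArc n p} :=
  {p | ∃ a b, D.Adj a b ∧ IsChord n p.1 a b}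

theorem isNoncrossing_chordSet {n : ℕ} {D : SimpleGraph (Fin (2 * n + 2))} (hD : IsDissection D)
    (hs : ∀ a b, D.Adj a b → D.Adj (a + ⟨n + 1, by omega⟩) (b + ⟨n + 1, by omega⟩)) :
    IsNoncrossing (cycCross n) (chordSet D) := by
  rintro p ⟨a, b, hab, hp⟩ q ⟨c, d, hcd, hq⟩ hc
  have hbound : ∀ {p : {p // IsCycArc n p}} {x y : ℕ},
      (IsChord n p.1 x y ∨ IsChord n p.1 y x) → x ≤ 2 * n + 1 := fun {p x y} h => by
    have e1 := chordEnd_spec p.2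
    have := p.2
    simp only [IsChord, IsCycArc] at *
    omega
  refine exists_isChord_of_cyclicallyCross p.2 q.2 hc fun x y z w hx hz => ?_
  have h1 : D.Adj ⟨x, by have := hbound hx; omega⟩ ⟨y, by have := hbound hx.symm; omega⟩ :=
    adj_of_isChord hs p.2 (Or.inl hp) hx hab
  have h2 : D.Adj ⟨z, by have := hbound hz; omega⟩ ⟨w, by have := hbound hz.symm; omega⟩ :=
    adj_of_isChord hs q.2 (Or.inl hq) hz hcd
  exact ⟨hD.noncrossing _ _ _ _ h1 h2, hD.noncrossing _ _ _ _ h2 h1⟩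

/-- The noncrossing sets of arcs are the centrally symmetric dissections. -/
def noncrossingSetsCycIso (n : ℕ) : NoncrossingSets (cycCross n) ≃o CSDissection n where
  toFun S := ⟨chordGraph S.1, isDissection_chordGraph S.2, chordGraph_symm S.1⟩
  invFun D := ⟨chordSet D.1, isNoncrossing_chordSet D.2.1 D.2.2⟩
  left_inv S := by
    apply Subtype.ext
    ext p
    constructor
    · rintro ⟨a, b, ⟨q, hq, hqab⟩, hp⟩
      rwa [Subtype.ext (IsChord.unique p.2 q.2 (Or.inl hp) hqab)]
    · intro hp
      have e1 := chordEnd_spec p.2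
      have := p.2
      refine ⟨⟨p.1.1, by omega⟩, ⟨chordEnd n p.1, by omega⟩, ⟨p, hp, ?_⟩, ?_⟩
      · exact Or.inl (Or.inl ⟨rfl, rfl⟩)
      · exact Or.inl ⟨rfl, rfl⟩
  right_inv D := by
    apply Subtype.ext
    ext a b
    constructor
    · rintro ⟨p, ⟨c, d, hcd, hp⟩, hpab⟩
      exact adj_of_isChord D.2.2 p.2 (Or.inl hp) hpab hcd
    · have main : ∀ a b : Fin (2 * n + 2), D.1.Adj a b → a < b →
          (chordGraph (chordSet D.1)).Adj a b := fun a b hab hlt => by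
        have h1 := D.2.1.diagonal a b hab hlt
        obtain ⟨p, hp, hpab⟩ := exists_isChord (n := n) h1.1 (by omega) (by omega)
        refine ⟨⟨p, hp⟩, ?_, hpab⟩
        rcases hpab with h | h
        · exact ⟨a, b, hab, h⟩
        · exact ⟨b, a, hab.symm, h⟩
      intro hab
      rcases lt_or_gt_of_ne hab.ne with h | h
      · exact main a b hab h
      · exact (main b a hab.symm h).symm
  map_rel_iff' {S T} := by
    constructor
    · intro hST p hp
      have e1 := chordEnd_spec p.2
      have := p.2
      obtain ⟨q, hq, hqp⟩ := @hST ⟨p.1.1, by omega⟩ ⟨chordEnd n p.1, by omega⟩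
        ⟨p, hp, Or.inl (Or.inl ⟨rfl, rfl⟩)⟩
      rwa [Subtype.ext (IsChord.unique p.2 q.2 (Or.inl (Or.inl ⟨rfl, rfl⟩)) hqp)]
    · rintro hST a b ⟨p, hp, h⟩
      exact ⟨p, hST hp, h⟩

/-- The graph on the vertices of the `(d + 3)`-gon of a set of diagonals. -/
def diagonalGraph {d : ℕ} (S : Set {p // IsLinArc d p}) : SimpleGraph (Fin (d + 3)) where
  Adj a b := ∃ p ∈ S, p.1 = (a.val, b.val) ∨ p.1 = (b.val, a.val)
  symm := ⟨fun _ _ ⟨p, hp, h⟩ => ⟨p, hp, h.symm⟩⟩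
  loopless := ⟨fun a ⟨p, _, h⟩ => by
    have := p.2
    rcases h with h | h <;> simp only [h, IsLinArc] at this <;> omega⟩

/-- The noncrossing sets of diagonals are the dissections. -/
def noncrossingSetsLinIso (d : ℕ) : NoncrossingSets (linCross d) ≃o Dissection d where
  toFun S := ⟨diagonalGraph S.1,
    { diagonal := by
        rintro a b ⟨p, -, hp⟩ hab
        have := p.2
        rw [Fin.lt_def] at hab
        rcases hp with hp | hp <;> simp only [hp, IsLinArc] at this <;> omega
      noncrossing := by
        rintro a b c e ⟨p, hpS, hp⟩ ⟨q, hqS, hq⟩ ⟨h1, h2, h3⟩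
        refine S.2 p hpS q hqS ?_
        change linRel p.1 q.1
        have h4 := p.2
        have h5 := q.2
        rw [Fin.lt_def] at h1 h2 h3
        rcases hp with hp | hp <;> rcases hq with hq | hq <;>
        simp only [hp, hq, IsLinArc, linRel] at h4 h5 ⊢ <;> omega }⟩
  invFun D := ⟨{p | D.1.Adj ⟨p.1.1, by have := p.2; omega⟩ ⟨p.1.2, by have := p.2; omega⟩},
    fun p hp q hq hpq => by
      rcases hpq with h | h
      · exact D.2.noncrossing _ _ _ _ hp hq h
      · exact D.2.noncrossing _ _ _ _ hq hp h⟩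
  left_inv S := by
    apply Subtype.ext
    ext p
    constructor
    · rintro ⟨q, hq, hqp | hqp⟩
      · rwa [← Subtype.ext hqp]
      · have h1 := p.2
        have h2 := q.2
        simp only [hqp, IsLinArc] at h1 h2
        omega
    · exact fun hp => ⟨p, hp, Or.inl rfl⟩
  right_inv D := by
    apply Subtype.ext
    ext a b
    constructor
    · rintro ⟨⟨p, hp⟩, hpD, hqp | hqp⟩
      · subst hqp
        exact hpD
      · subst hqp
        exact hpD.symm
    · have main : ∀ a b : Fin (d + 3), ∀ hab : D.1.Adj a b, a < b → ∃ h : IsLinArc d (a.val, b.val),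
          D.1.Adj ⟨a.val, a.isLt⟩ ⟨b.val, b.isLt⟩ := fun a b hab hlt => by
        have h1 := D.2.diagonal a b hab hlt
        have := b.isLt
        exact ⟨by simp only [IsLinArc]; omega, hab⟩
      intro hab
      rcases lt_or_gt_of_ne hab.ne with h | h
      · obtain ⟨h1, h2⟩ := main a b hab h
        exact ⟨⟨_, h1⟩, h2, Or.inl rfl⟩
      · obtain ⟨h1, h2⟩ := main b a hab.symm h
        exact ⟨⟨_, h1⟩, h2, Or.inr rfl⟩
  map_rel_iff' {S T} := by
    constructor
    · intro hST p hp
      have h1 := p.2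
      obtain ⟨q, hq, hqp | hqp⟩ := @hST ⟨p.1.1, by omega⟩ ⟨p.1.2, by omega⟩ ⟨p, hp, Or.inl rfl⟩
      · rwa [← Subtype.ext hqp]
      · have h2 := q.2
        simp only [hqp, IsLinArc] at h1 h2
        omega
    · rintro hST a b ⟨p, hp, h⟩
      exact ⟨p, hST hp, h⟩

end DissectionPosets

/-! ### Relations built from a cyclic model and polygons are closed under links. -/

section Polygonal

/-- The crossing relations assembled from one cyclic model and finitely many polygons. -/
inductive IsPolygonal : (A : Type) → (A → A → Prop) → Prop
  | cyc (n : ℕ) : IsPolygonal _ (cycCross n)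
  | sum {A : Type} {r : A → A → Prop} (d : ℕ) (hr : IsPolygonal A r) :
      IsPolygonal _ (Sum.LiftRel (linCross d) r)
  | iso {A B : Type} {r : A → A → Prop} {s : B → B → Prop} (f : r ≃r s) (hr : IsPolygonal A r) :
      IsPolygonal B s

variable {A B C D : Type*} {r : A → A → Prop} {s : B → B → Prop} {t : C → C → Prop}
  {u : D → D → Prop}

/-- Relation isomorphisms of the summands. -/
def sumLiftRelCongr (f : r ≃r t) (g : s ≃r u) : Sum.LiftRel r s ≃r Sum.LiftRel t u where
  toEquiv := f.toEquiv.sumCongr g.toEquiv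
  map_rel_iff' {a b} := by
    rcases a with a | a <;> rcases b with b | b
    · simpa using f.map_rel_iff
    · simp
    · simp
    · simpa using g.map_rel_iff

/-- Associativity of the disjoint union of relations. -/
def sumLiftRelAssoc (r : A → A → Prop) (s : B → B → Prop) (t : C → C → Prop) :
    Sum.LiftRel (Sum.LiftRel r s) t ≃r Sum.LiftRel r (Sum.LiftRel s t) where
  toEquiv := Equiv.sumAssoc A B C
  map_rel_iff' {a b} := by
    rcases a with (a | a) | a <;> rcases b with (b | b) | b <;> simp

/-- The link of an element of the first summand. -/
def linkInl (r : A → A → Prop) (s : B → B → Prop) (e : A) :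
    Sum.LiftRel (subRel r (InLink r e)) s ≃r
      subRel (Sum.LiftRel r s) (InLink (Sum.LiftRel r s) (Sum.inl e)) where
  toFun := Sum.elim
    (fun a => ⟨Sum.inl a.1, fun h => a.2.1 (Sum.inl_injective h), by simpa using a.2.2⟩)
    fun b => ⟨Sum.inr b, by simp, by simp⟩
  invFun c := match c with
    | ⟨Sum.inl a, h⟩ => Sum.inl ⟨a, fun he => h.1 (congrArg _ he), by simpa using h.2⟩
    | ⟨Sum.inr b, _⟩ => Sum.inr b
  left_inv := by rintro (a | b) <;> rfl
  right_inv := by rintro ⟨a | b, h⟩ <;> rfl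
  map_rel_iff' {a b} := by
    rcases a with a | a <;> rcases b with b | b <;> simp [subRel]

/-- The link of an element of the second summand. -/
def linkInr (r : A → A → Prop) (s : B → B → Prop) (e : B) :
    Sum.LiftRel r (subRel s (InLink s e)) ≃r
      subRel (Sum.LiftRel r s) (InLink (Sum.LiftRel r s) (Sum.inr e)) where
  toFun := Sum.elim (fun a => ⟨Sum.inl a, by simp, by simp⟩)
    fun b => ⟨Sum.inr b.1, fun h => b.2.1 (Sum.inr_injective h), by simpa using b.2.2⟩
  invFun c := match c with
    | ⟨Sum.inl a, _⟩ => Sum.inl a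
    | ⟨Sum.inr b, h⟩ => Sum.inr ⟨b, fun he => h.1 (congrArg _ he), by simpa using h.2⟩
  left_inv := by rintro (a | b) <;> rfl
  right_inv := by rintro ⟨a | b, h⟩ <;> rfl
  map_rel_iff' {a b} := by
    rcases a with a | a <;> rcases b with b | b <;> simp [subRel]

/-- Cyclic models and polygons split as computed above, and in a disjoint sum the link changes only
the summand containing the element. -/
theorem IsPolygonal.link {A : Type} {r : A → A → Prop} (hr : IsPolygonal A r) (e : A) :
    IsPolygonal _ (subRel r (InLink r e)) := by
  induction hr with
  | cyc n =>
    obtain ⟨d, b, ⟨f⟩⟩ := nonempty_relIso_link_cycCross e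
    exact .iso f (.sum d (.cyc b))
  | @sum A r d hr ih =>
    rcases e with e | e
    · obtain ⟨d₁, d₂, ⟨f⟩⟩ := nonempty_relIso_link_linCross e
      exact .iso (((sumLiftRelAssoc _ _ _).symm.trans
        (sumLiftRelCongr f (RelIso.refl r))).trans (linkInl _ _ e)) (.sum d₁ (.sum d₂ hr))
    · exact .iso (linkInr _ _ e) (.sum d (ih e))
  | iso f hr ih =>
    have h1 := (f.link (f.symm e))
    rw [f.apply_symm_apply] at h1
    exact .iso h1 (ih _)

/-- The condition on an element to lie in the link of the set `S`. -/
abbrev InLinkSet {A : Type*} (r : A → A → Prop) (S : Set A) (a : A) : Prop :=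
  a ∉ S ∧ ∀ s ∈ S, ¬ r a s

/-- The link of `insert e S` is a link in the link of `S`. -/
def linkInsert {A : Type*} (r : A → A → Prop) {S : Set A} {e : A} (he : InLinkSet r S e) :
    subRel (subRel r (InLinkSet r S)) (InLink (subRel r (InLinkSet r S)) ⟨e, he⟩) ≃r
      subRel r (InLinkSet r (insert e S)) where
  toFun a := ⟨a.1.1, fun h => h.elim (fun h => a.2.1 (Subtype.ext h)) a.1.2.1, fun s hs =>
    hs.elim (fun h => h ▸ a.2.2) (a.1.2.2 s)⟩
  invFun a := ⟨⟨a.1, fun h => a.2.1 (Or.inr h), fun s hs => a.2.2 s (Or.inr hs)⟩,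
    fun h => a.2.1 (Or.inl (congrArg Subtype.val h)), a.2.2 e (Or.inl rfl)⟩
  left_inv _ := rfl
  right_inv _ := rfl
  map_rel_iff' := Iff.rfl

theorem IsPolygonal.linkSet {A : Type} {r : A → A → Prop} (hr : IsPolygonal A r) {S : Set A}
    (hfin : S.Finite) (hS : IsNoncrossing r S) : IsPolygonal _ (subRel r (InLinkSet r S)) := by
  induction S, hfin using Set.Finite.induction_on with
  | empty =>
    refine .iso (⟨(Equiv.subtypeUnivEquiv fun a => ?_).symm, Iff.rfl⟩ :
      r ≃r subRel r (InLinkSet r ∅)) hr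
    exact ⟨Set.notMem_empty a, fun s hs => hs.elim⟩
  | @insert e S he _ ih =>
    have h1 := ih fun p hp q hq => hS p (Or.inr hp) q (Or.inr hq)
    exact .iso (linkInsert r ⟨he, fun s hs => hS e (Or.inl rfl) s (Or.inr hs)⟩) (h1.link _)

/-- The product of two order isomorphisms. -/
def orderIsoProdCongr {α β γ δ : Type*} [Preorder α] [Preorder β] [Preorder γ] [Preorder δ]
    (f : α ≃o γ) (g : β ≃o δ) : α × β ≃o γ × δ where
  toEquiv := f.toEquiv.prodCongr g.toEquiv
  map_rel_iff' := and_congr f.map_rel_iff g.map_rel_iff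

theorem IsPolygonal.exists_orderIso {A : Type} {r : A → A → Prop} (hr : IsPolygonal A r) :
    ∃ (k : ℕ) (a : Fin k → ℕ) (b : ℕ),
      Nonempty (NoncrossingSets r ≃o (∀ t, Dissection (a t)) × CSDissection b) := by
  induction hr with
  | cyc n =>
    refine ⟨0, Fin.elim0, n, ⟨(noncrossingSetsCycIso n).trans ?_⟩⟩
    exact ⟨(Equiv.uniqueProd _ _).symm, by
      intro x y
      simp [Prod.le_def]⟩
  | @sum A r d hr ih =>
    obtain ⟨k, a, b, ⟨f⟩⟩ := ih
    refine ⟨k + 1, Fin.cons d a, b, ⟨(noncrossingSetsSum _ _).trans ?_⟩⟩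
    refine (orderIsoProdCongr (noncrossingSetsLinIso d) f).trans ?_
    refine (OrderIso.prodAssoc _ _ _).symm.trans (orderIsoProdCongr ?_ (OrderIso.refl _))
    exact Fin.consOrderIso fun t : Fin (k + 1) => Dissection (Fin.cons (α := fun _ => ℕ) d a t)
  | iso f hr ih =>
    obtain ⟨k, a, b, ⟨g⟩⟩ := ih
    exact ⟨k, a, b, ⟨f.noncrossingSets.symm.trans g⟩⟩

/-- An embedding of relations whose image contains the link of the image of `S` induces an
isomorphism of links. -/
theorem nonempty_relIso_linkSet (φ : r ↪r s) {S : Set A}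
    (hS : ∀ c, InLinkSet s (φ '' S) c → c ∈ Set.range φ) :
    Nonempty (subRel r (InLinkSet r S) ≃r subRel s (InLinkSet s (φ '' S))) := by
  have hiff : ∀ a, InLinkSet r S a ↔ InLinkSet s (φ '' S) (φ a) := fun a => by
    simp only [InLinkSet, φ.injective.mem_set_image, Set.forall_mem_image, φ.map_rel_iff]
  refine ⟨⟨Equiv.ofBijective (fun a => ⟨φ a.1, (hiff _).1 a.2⟩) ⟨fun a b hab => ?_, ?_⟩, ?_⟩⟩
  · exact Subtype.ext (φ.injective (congrArg Subtype.val hab))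
  · rintro ⟨c, hc⟩
    obtain ⟨a, rfl⟩ := hS c hc
    exact ⟨⟨a, (hiff _).2 hc⟩, rfl⟩
  · exact φ.map_rel_iff

end Polygonal

/-! ### Arcs of I × J̄ in the cyclic model, predecessors and consecutive pairs. -/

section ArcLengths

theorem arcLength_self_lt_right {n i j : ℕ} (hi : i ≤ n) (hj : j ≤ n) (hij : i ≠ j) :
    arcLength n i i < arcLength n i j := by
  rw [arcLength_lt_right_iff hi hi hj]
  omega

theorem arcLength_self_lt_left {n i j : ℕ} (hi : i ≤ n) (hj : j ≤ n) (hij : i ≠ j) :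
    arcLength n j j < arcLength n i j := by
  rw [arcLength_lt_left_iff hi hj hj]
  omega

theorem arcLength_injective_right {n i j j' : ℕ} (hi : i ≤ n) (hj : j ≤ n) (hj' : j' ≤ n)
    (he : arcLength n i j = arcLength n i j') : j = j' := by
  rw [arcLength_eq_ite hi hj, arcLength_eq_ite hi hj'] at he
  split_ifs at he <;> omega

theorem arcLength_injective_left {n i i' j : ℕ} (hi : i ≤ n) (hi' : i' ≤ n) (hj : j ≤ n)
    (he : arcLength n i j = arcLength n i' j) : i = i' := by
  rw [arcLength_eq_ite hi hj, arcLength_eq_ite hi' hj] at he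
  split_ifs at he <;> omega

/-- The lengths of the arcs in `I × J̄`. -/
def arcLengths (n : ℕ) (I J : Finset ℕ) (i : I) (j : J) : ℤ := arcLength n i j

variable {n : ℕ} {I J : Finset ℕ}

/-- Ranking the positions of I ⊔ J̄ embeds I × J̄ into the cyclic model, preserving crossings. Since
`G` has no isolated node, every arc of the model that does not run from I to J̄ crosses an arc of
`G`, so passing to the larger model leaves the link of `G` unchanged. -/
theorem exists_orderIso_noncrossingAbove (hI : ∀ i ∈ I, i ≤ n) (hJ : ∀ j ∈ J, j ≤ n)
    {G : Set (I × J)} (hGL : CoversLeft G) (hGR : CoversRight G)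
    (hG : IsNoncrossing (ArcCross (arcLengths n I J)) G) :
    ∃ (k : ℕ) (a : Fin k → ℕ) (b : ℕ),
      Nonempty (NoncrossingAbove (ArcCross (arcLengths n I J)) G ≃o
        (∀ t, Dissection (a t)) × CSDissection b) := by
  let e := (positions I J).orderIsoOfFin rfl
  have hIp : ∀ i : I, 2 * i.1 ∈ positions I J := fun i =>
    Finset.mem_union_left _ (Finset.mem_image_of_mem (fun i => 2 * i) i.2)
  have hJp : ∀ j : J, 2 * j.1 + 1 ∈ positions I J := fun j =>
    Finset.mem_union_right _ (Finset.mem_image_of_mem (fun j => 2 * j + 1) j.2)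
  let rk : positions I J → ℕ := fun p => (e.symm p).val
  have hlt : ∀ p q, rk p < rk q ↔ p.1 < q.1 := fun p q => e.symm.lt_iff_lt
  have hle : ∀ p q, rk p ≤ rk q ↔ p.1 ≤ q.1 := fun p q => e.symm.le_iff_le
  have hN : ∀ p, rk p ≤ (positions I J).card - 1 := fun p => by
    have := (e.symm p).isLt
    simp only [rk]
    omega
  let φ : I × J → {p // IsCycArc ((positions I J).card - 1) p} := fun p =>
    ⟨(rk ⟨_, hIp p.1⟩, rk ⟨_, hJp p.2⟩), hN _, hN _, fun he => by
      have h1 := (hle _ _).1 he.le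
      have h2 := (hle _ _).1 he.ge
      simp only at h1 h2
      omega⟩
  have hφ : Function.Injective φ := by
    rintro ⟨i, j⟩ ⟨i', j'⟩ hpq
    have h0 := congrArg Subtype.val hpq
    have h1 : rk ⟨_, hIp i⟩ = rk ⟨_, hIp i'⟩ := congrArg Prod.fst h0
    have h2 : rk ⟨_, hJp j⟩ = rk ⟨_, hJp j'⟩ := congrArg Prod.snd h0
    have h3 := (hle _ _).1 h1.le
    have h4 := (hle _ _).1 h1.ge
    have h5 := (hle _ _).1 h2.le
    have h6 := (hle _ _).1 h2.ge
    simp only at h3 h4 h5 h6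
    exact Prod.ext (Subtype.ext (by simp only; omega)) (Subtype.ext (by simp only; omega))
  have hcross : ∀ (i : I) (j : J) (i' : I) (j' : J), CyclicallyCross ((positions I J).card - 1)
      (rk ⟨_, hIp i⟩) (rk ⟨_, hJp j⟩) (rk ⟨_, hIp i'⟩) (rk ⟨_, hJp j'⟩) ↔
      CyclicallyCross n i j i' j' := fun i j i' j' => by
    refine cyclicallyCross_congr (hI _ i.2) (hJ _ j.2) (hI _ i'.2) (hJ _ j'.2) (hN _) (hN _)
      (hN _) (hN _) ?_ ?_ ?_ ?_ ?_ ?_ ?_ ?_ <;> simp only [hlt, hle] <;> omega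
  let Φ : ArcCross (arcLengths n I J) ↪r cycCross ((positions I J).card - 1) :=
    ⟨⟨φ, hφ⟩, by
      rintro ⟨i, j⟩ ⟨i', j'⟩
      exact hcross i j i' j'⟩
  have hcov : ∀ c, InLinkSet (cycCross ((positions I J).card - 1)) (Φ '' G) c →
      c ∈ Set.range Φ := by
    rintro ⟨⟨u, v⟩, hu, hv, huv⟩ ⟨-, hc⟩
    simp only at hu hv huv
    have hsurj : ∀ u, u ≤ (positions I J).card - 1 → ∃ p, rk p = u := fun w hw => by
      have hpos : 0 < (positions I J).card := by
        by_contra h0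
        rw [Nat.pos_iff_ne_zero, not_not, Finset.card_eq_zero] at h0
        have hemp : IsEmpty J := ⟨fun j => by simpa [h0] using hJp j⟩
        have hempI : IsEmpty I := ⟨fun i => by simpa [h0] using hIp i⟩
        rw [h0] at hu hv
        simp only [Finset.card_empty] at hu hv
        omega
      exact ⟨e ⟨w, by omega⟩, by simp [rk]⟩
    obtain ⟨⟨p, hp⟩, rfl⟩ := hsurj u hu
    obtain ⟨⟨q, hq⟩, rfl⟩ := hsurj v hv
    have hp' := hp
    have hq' := hq
    simp only [positions, Finset.mem_union, Finset.mem_image] at hp' hq'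
    rcases hp' with ⟨i, hi, rfl⟩ | ⟨j, hj, rfl⟩
    · rcases hq' with ⟨i', hi', rfl⟩ | ⟨j, hj, rfl⟩
      -- An arc ending at the position of `i'` crosses every arc of `G` starting there, because the
      -- trivial arc at that position has length zero. The case of an arc starting at an element of
      -- J̄ is symmetric.
      · exfalso
        obtain ⟨j', hj'⟩ := hGL ⟨i', hi'⟩
        have hm := (φ (⟨i', hi'⟩, j')).2
        refine hc _ ⟨_, hj', rfl⟩ (Or.inl ⟨?_, ?_⟩)
        · exact arcLength_self_lt_left hu hv huv
        · exact arcLength_self_lt_right hm.1 hm.2.1 hm.2.2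
      · exact ⟨(⟨i, hi⟩, ⟨j, hj⟩), rfl⟩
    · exfalso
      obtain ⟨i', hi'⟩ := hGR ⟨j, hj⟩
      have hm := (φ (i', ⟨j, hj⟩)).2
      refine hc _ ⟨_, hi', rfl⟩ (Or.inr ⟨?_, ?_⟩)
      · exact arcLength_self_lt_right hu hv huv
      · exact arcLength_self_lt_left hm.1 hm.2.1 hm.2.2
  obtain ⟨f⟩ := nonempty_relIso_linkSet Φ hcov
  have hpoly := IsPolygonal.iso f.symm ((IsPolygonal.cyc _).linkSet (Set.toFinite (Φ '' G)) <| by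
    rintro _ ⟨p, hp, rfl⟩ _ ⟨q, hq, rfl⟩ hpq
    exact hG p hp q hq (Φ.map_rel_iff.1 hpq))
  obtain ⟨k, a, b, ⟨g⟩⟩ := hpoly.exists_orderIso
  exact ⟨k, a, b, ⟨(noncrossingAboveIso hG fun _ _ => ArcCross.symm).trans g⟩⟩

/-- The arcs from `ι j` to `j`, as a graph on two copies of `J`. -/
def diagonalArcs (J : Type*) : Set (J × J) := {p | p.1 = p.2}

/-- `ι j` is the last element of `I` before `j`, and no element of `J` lies between them. -/
structure IsPredecessor (n : ℕ) (I J : Finset ℕ) (ι : J → I) : Prop where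
  left : ∀ (i : I) (j : J), arcLength n (ι j) j ≤ arcLength n i j
  right : ∀ j k : J, arcLength n (ι j) j ≤ arcLength n (ι j) k

theorem IsPredecessor.isNoncrossing_diagonalArcs {ι : J → I} (hι : IsPredecessor n I J ι) :
    IsNoncrossing (ArcCross fun j => arcLengths n I J (ι j)) (diagonalArcs J) := by
  rintro ⟨a, a'⟩ ha ⟨b, b'⟩ hb hc
  obtain rfl : a = a' := ha
  obtain rfl : b = b' := hb
  rcases hc with ⟨-, h⟩ | ⟨h, -⟩
  · exact absurd (hι.right b a) (not_le.2 h)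
  · exact absurd (hι.right a b) (not_le.2 h)

/-- No element of J lies between ι a and a, so replacing ι a by a shifts all lengths in the row by
the same constant; the cyclic order of the starting points relative to any element of J is unchanged
as well. -/
theorem IsPredecessor.cross_iff {ι : J → I} (hι : IsPredecessor n I J ι) (hI : ∀ i ∈ I, i ≤ n)
    (hJ : ∀ j ∈ J, j ≤ n) (a b a' b' : J) :
    ArcCross (fun j => arcLengths n I J (ι j)) (a, b) (a', b') ↔
      CyclicallyCross n a b a' b' := by
  have hform : ∀ a b : J, arcLength n (ι a) b = arcLength n (ι a) a + arcLength n a b := by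
    intro a b
    have h1 := hι.right a b
    rw [arcLength_eq_ite (hI _ (ι a).2) (hJ _ a.2), arcLength_eq_ite (hI _ (ι a).2) (hJ _ b.2)] at *
    rw [arcLength_eq_ite (hJ _ a.2) (hJ _ b.2)]
    have := hI _ (ι a).2
    have := hJ _ a.2
    have := hJ _ b.2
    split_ifs at * <;> omega
  have hr : ∀ a b b' : J, arcLength n (ι a) b < arcLength n (ι a) b' ↔
      arcLength n a b < arcLength n a b' := fun a b b' => by
    rw [hform a b, hform a b']
    omega
  have hl : ∀ a a' b : J, arcLength n (ι a') b < arcLength n (ι a) b ↔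
      arcLength n a' b < arcLength n a b := by
    intro a a' b
    have hr' := fun a k : J => (not_lt.2 (hι.right a k))
    have hl' := fun a k : J => (not_lt.2 (hι.left (ι k) a))
    simp only [arcLength_lt_right_iff (hI _ (ι _).2) (hJ _ (Subtype.prop _)) (hJ _ (Subtype.prop _)),
      arcLength_lt_left_iff (hI _ (ι _).2) (hI _ (ι _).2) (hJ _ (Subtype.prop _))] at hr' hl'
    rw [arcLength_lt_left_iff (hI _ (ι a).2) (hI _ (ι a').2) (hJ _ b.2),
      arcLength_lt_left_iff (hJ _ a.2) (hJ _ a'.2) (hJ _ b.2)]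
    have h1 := hr' a a'
    have h2 := hr' a' a
    have h3 := hl' a a'
    have h4 := hl' a' a
    have h5 := hr' a b
    have h6 := hr' a' b
    omega
  change CyclicallyCross n (ι a) b (ι a') b' ↔ _
  rw [CyclicallyCross, CyclicallyCross, hl, hr, hr, hl]

/-- The arcs (ι j, j) cross no other arc, so their link consists of all arcs with distinct indices
in J, which after ranking is the full cyclic model on |J| elements. -/
theorem IsPredecessor.nonempty_orderIso {ι : J → I} (hι : IsPredecessor n I J ι)
    (hI : ∀ i ∈ I, i ≤ n) (hJ : ∀ j ∈ J, j ≤ n) :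
    Nonempty (NoncrossingAbove (ArcCross fun j => arcLengths n I J (ι j)) (diagonalArcs J) ≃o
      CSDissection (J.card - 1)) := by
  let e := J.orderIsoOfFin rfl
  have hN : ∀ p, (e.symm p).val ≤ J.card - 1 := fun p => by
    have := (e.symm p).isLt
    omega
  have hlt : ∀ p q, (e.symm p).val < (e.symm q).val ↔ p.1 < q.1 := fun p q => e.symm.lt_iff_lt
  have hle : ∀ p q, (e.symm p).val ≤ (e.symm q).val ↔ p.1 ≤ q.1 := fun p q => e.symm.le_iff_le
  have hlink : ∀ p : J × J, InLinkSet (ArcCross fun j => arcLengths n I J (ι j))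
      (diagonalArcs J) p ↔ p.1 ≠ p.2 := by
    rintro ⟨a, b⟩
    refine ⟨And.left, fun hab => ⟨hab, ?_⟩⟩
    rintro ⟨c, c'⟩ hc hcr
    obtain rfl : c = c' := hc
    rcases hcr with ⟨-, h⟩ | ⟨-, h⟩
    · exact absurd (hι.right c b) (not_le.2 h)
    · exact absurd (hι.left (ι a) c) (not_le.2 h)
  have hcard : ∀ {q : ℕ × ℕ}, IsCycArc (J.card - 1) q → q.1 < J.card ∧ q.2 < J.card :=
    fun {q} hq => by
      simp only [IsCycArc] at hq
      omega
  have hcross : ∀ a b a' b' : J, CyclicallyCross (J.card - 1) (e.symm a) (e.symm b) (e.symm a')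
      (e.symm b') ↔ CyclicallyCross n a b a' b' := fun a b a' b' => by
    refine cyclicallyCross_congr (hJ _ a.2) (hJ _ b.2) (hJ _ a'.2) (hJ _ b'.2) (hN _) (hN _)
      (hN _) (hN _) ?_ ?_ ?_ ?_ ?_ ?_ ?_ ?_ <;> simp only [hlt, hle]
  let f : subRel (ArcCross fun j => arcLengths n I J (ι j))
      (InLinkSet (ArcCross fun j => arcLengths n I J (ι j)) (diagonalArcs J)) ≃r
      cycCross (J.card - 1) :=
    { toFun := fun p => ⟨((e.symm p.1.1).val, (e.symm p.1.2).val), hN _, hN _, fun he =>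
        (hlink p.1).1 p.2 (e.symm.injective (Fin.ext he))⟩
      invFun := fun q => ⟨(e ⟨q.1.1, (hcard q.2).1⟩, e ⟨q.1.2, (hcard q.2).2⟩), (hlink _).2 fun he =>
        q.2.2.2 (congrArg Fin.val (e.injective he))⟩
      left_inv := fun p => by simp
      right_inv := fun q => by simp
      map_rel_iff' := by
        rintro ⟨⟨a, b⟩, hab⟩ ⟨⟨a', b'⟩, hab'⟩
        exact (hcross a b a' b').trans (hι.cross_iff hI hJ a b a' b').symm }
  exact ⟨((noncrossingAboveIso hι.isNoncrossing_diagonalArcs fun _ _ => ArcCross.symm).trans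
    f.noncrossingSets).trans (noncrossingSetsCycIso _)⟩

/-- Choose for each `a` the nearest element of I before it. Either this choice is a predecessor map,
or some `k` in J lies between an `a` and its choice. -/
theorem exists_isPredecessor_or (hIne : I.Nonempty) :
    (∃ ι : J → I, IsPredecessor n I J ι) ∨
    ∃ i ∈ I, ∃ a ∈ J, ∃ k ∈ J, arcLength n i k < arcLength n i a ∧
      ∀ i' ∈ I, arcLength n i a ≤ arcLength n i' a := by
  have hmin : ∀ a : J, ∃ i ∈ I, ∀ i' ∈ I, arcLength n i a ≤ arcLength n i' a := fun a =>
    I.exists_min_image _ hIne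
  choose ι hι hιmin using hmin
  by_cases h : ∀ j k : J, arcLength n (ι j) j ≤ arcLength n (ι j) k
  · exact Or.inl ⟨fun a => ⟨ι a, hι a⟩, fun i j => hιmin j i i.2, h⟩
  · push Not at h
    obtain ⟨a, k, hak⟩ := h
    exact Or.inr ⟨ι a, hι a, a, a.2, k, k.2, hak, hιmin a⟩

theorem hasCyclicallyConsecutivePair_iff (hI : ∀ i ∈ I, i ≤ n) (hJ : ∀ j ∈ J, j ≤ n)
    (hIne : I.Nonempty) : HasCyclicallyConsecutivePair I J ↔
    ∃ i ∈ I, ∃ a ∈ J, ∃ k ∈ J, arcLength n i k < arcLength n i a ∧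
      ∀ i' ∈ I, arcLength n i a ≤ arcLength n i' a := by
  constructor
  · rintro ⟨j, hj, j', hj', hjj, h | h⟩
    · obtain ⟨i, hi, hmin⟩ := I.exists_min_image (fun i => arcLength n i j') hIne
      refine ⟨i, hi, j', hj', j, hj, ?_, hmin⟩
      have h1 := h (2 * i) (Finset.mem_union_left _ (Finset.mem_image_of_mem (fun i => 2 * i) hi))
      rw [arcLength_lt_right_iff (hI i hi) (hJ j hj) (hJ j' hj')]
      omega
    · obtain ⟨i, hi, hmin⟩ := I.exists_min_image (fun i => arcLength n i j) hIne
      refine ⟨i, hi, j, hj, j', hj', ?_, hmin⟩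
      have h1 := h (2 * i) (Finset.mem_union_left _ (Finset.mem_image_of_mem (fun i => 2 * i) hi))
      rw [arcLength_lt_right_iff (hI i hi) (hJ j' hj') (hJ j hj)]
      omega
  · rintro ⟨i, hi, a, ha, k, hk, hka, hmin⟩
    -- Replacing `k` by the last element of J before `a` on the way from `i` makes the pair
    -- cyclically consecutive.
    obtain ⟨k, hk, hmax⟩ := (J.filter fun k => arcLength n i k < arcLength n i a).exists_max_image
      (fun k => arcLength n i k) ⟨k, Finset.mem_filter.2 ⟨hk, hka⟩⟩
    obtain ⟨hk, hka⟩ := Finset.mem_filter.1 hk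
    have hmax' : ∀ b ∈ J, ¬ (arcLength n i b < arcLength n i a ∧ arcLength n i k < arcLength n i b) :=
      fun b hb hc => absurd (hmax b (Finset.mem_filter.2 ⟨hb, hc.1⟩)) (not_le.2 hc.2)
    have hin := hI i hi
    have hkn := hJ k hk
    have han := hJ a ha
    rw [arcLength_lt_right_iff hin hkn han] at hka
    rcases lt_or_gt_of_ne (show k ≠ a by omega) with hlt | hlt
    · refine ⟨k, hk, a, ha, hlt, Or.inl fun p hp hpp => ?_⟩
      simp only [positions, Finset.mem_union, Finset.mem_image] at hp
      rcases hp with ⟨i', hi', rfl⟩ | ⟨b, hb, rfl⟩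
      · have h1 := hmin i' hi'
        rw [← not_lt, arcLength_lt_left_iff hin (hI i' hi') han] at h1
        omega
      · have h1 := hmax' b hb
        rw [arcLength_lt_right_iff hin (hJ b hb) han, arcLength_lt_right_iff hin hkn (hJ b hb)] at h1
        omega
    · refine ⟨a, ha, k, hk, hlt, Or.inr fun p hp => ?_⟩
      simp only [positions, Finset.mem_union, Finset.mem_image] at hp
      rcases hp with ⟨i', hi', rfl⟩ | ⟨b, hb, rfl⟩
      · have h1 := hmin i' hi'
        rw [← not_lt, arcLength_lt_left_iff hin (hI i' hi') han] at h1
        have := hI i' hi'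
        omega
      · have h1 := hmax' b hb
        rw [arcLength_lt_right_iff hin (hJ b hb) han, arcLength_lt_right_iff hin hkn (hJ b hb)] at h1
        omega

end ArcLengths

/-! ### Reentrant corners, face posets and dimension. -/

section Support

variable {I J : Type*} {h : I → J → ℝ} {j₀ : J} {G : Set (I × J)} {l : I → J → ℤ}

theorem covector_sub_const (h : I → J → ℝ) (x : J → ℝ) (c : ℝ) :
    covector h (fun j => x j - c) = covector h x := by
  ext p
  refine forall_congr' fun k => ?_
  constructor <;> intro hk <;> simp only at * <;> linarith

/-- If the region around the coordinate `j'` is reentrant, the support is not convex. -/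
theorem not_convex_support [Finite I] [Fintype J] {i₀ i₁ : I} {j j' k₀ : J} (hi : i₁ ≠ i₀)
    (hjj : j ≠ j') (hkj : k₀ ≠ j) (hkj' : k₀ ≠ j')
    (h₁ : ∀ i k, i ≠ i₀ → k ≠ j → k ≠ j' → h i k + h i₀ j' < h i j' + h i₀ k)
    (h₂ : ∀ i, i ≠ i₀ → h i₀ j + h i j' < h i₀ j' + h i j) :
    ¬ Convex ℝ (polyhedralSupport (boundedCells j₀ h)) := by
  classical
  have : Nontrivial J := ⟨⟨j, j', hjj⟩⟩
  intro hconv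
  -- Among the elements other than `i₀`, this `i` is the last for which `j'` loses to `k₀` when the
  -- coordinate at `k₀` is raised; at the midpoint below, `j'` then loses for all of them.
  obtain ⟨i, hi₀, hmax⟩ := Set.exists_max_image {i | i ≠ i₀} (fun i => h i k₀ - h i j')
    (Set.toFinite _) ⟨i₁, hi⟩
  have hi₀ : i ≠ i₀ := hi₀
  obtain ⟨ε, hε, hlt⟩ := exists_eps_of_finite
    (fun k : {k // k ≠ j ∧ k ≠ j'} => (h i j' + h i₀ k) - (h i k + h i₀ j')) (fun _ => 1)
    fun k => sub_pos.2 (h₁ i k hi₀ k.2.1 k.2.2)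
  let δ := min ε ((h i₀ j' + h i j) - (h i₀ j + h i j'))
  have hδ : 0 < δ := lt_min hε (sub_pos.2 (h₂ i hi₀))
  have hδ₁ : ∀ k, k ≠ j → k ≠ j' → δ ≤ (h i j' + h i₀ k) - (h i k + h i₀ j') := fun k hk hk' => by
    have := hlt ⟨k, hk, hk'⟩
    have := min_le_left ε ((h i₀ j' + h i j) - (h i₀ j + h i j'))
    simp only [mul_one] at *
    linarith
  have hδ₂ : δ ≤ (h i₀ j' + h i j) - (h i₀ j + h i j') := min_le_right _ _
  clear_value δ
  -- At s = t = 0, `i₀` ties `j` with `j'`, and `i` ties `j'` with every index other than `j`.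
  -- Raising only `s` leaves `j'` covered by `i₀`, raising only `t` leaves it covered by `i`, but
  -- raising both uncovers it.
  let x : ℝ → ℝ → J → ℝ := fun s t k =>
    if k = j' then 0 else if k = j then h i₀ j - h i₀ j' + t else h i k - h i j' + s
  have xj' : ∀ s t, x s t j' = 0 := fun s t => if_pos rfl
  have xj : ∀ s t, x s t j = h i₀ j - h i₀ j' + t := fun s t => by simp [x, hjj]
  have xk : ∀ s t k, k ≠ j → k ≠ j' → x s t k = h i k - h i j' + s := fun s t k hk hk' => by
    simp [x, hk, hk']
  have cases3 : ∀ {P : J → Prop}, P j' → P j → (∀ k, k ≠ j → k ≠ j' → P k) → ∀ k, P k :=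
    fun hj' hj hk k => by
      by_cases e1 : k = j'
      · exact e1 ▸ hj'
      · by_cases e2 : k = j
        · exact e2 ▸ hj
        · exact hk k e2 e1
  have hP₁ : CoversRight (covector h (x δ 0)) := by
    refine cases3 ⟨i₀, cases3 ?_ ?_ fun k hk hk' => ?_⟩ ⟨i₀, cases3 ?_ ?_ fun k hk hk' => ?_⟩
      fun k' hk hk' => ⟨i, cases3 ?_ ?_ fun k hk hk' => ?_⟩
    · exact le_rfl
    · simp only [xj, xj']
      linarith
    · have := hδ₁ k hk hk'
      simp only [xj', xk _ _ k hk hk']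
      linarith
    · simp only [xj, xj']
      linarith
    · exact le_rfl
    · have := hδ₁ k hk hk'
      simp only [xj, xk _ _ k hk hk']
      linarith
    · simp only [xj', xk _ _ k' hk hk']
      linarith
    · simp only [xj, xk _ _ k' hk hk']
      linarith
    · simp only [xk _ _ k' ‹k' ≠ j› ‹k' ≠ j'›, xk _ _ k hk hk']
      linarith
  have hP₂ : CoversRight (covector h (x 0 δ)) := by
    refine cases3 ⟨i, cases3 ?_ ?_ fun k hk hk' => ?_⟩ ⟨i₀, cases3 ?_ ?_ fun k hk hk' => ?_⟩
      fun k' hk hk' => ⟨i, cases3 ?_ ?_ fun k hk hk' => ?_⟩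
    · exact le_rfl
    · simp only [xj, xj']
      linarith
    · simp only [xj', xk _ _ k hk hk']
      linarith
    · simp only [xj, xj']
      linarith
    · exact le_rfl
    · have := hδ₁ k hk hk'
      simp only [xj, xk _ _ k hk hk']
      linarith
    · simp only [xj', xk _ _ k' hk hk']
      linarith
    · simp only [xj, xk _ _ k' hk hk']
      linarith
    · simp only [xk _ _ k' ‹k' ≠ j› ‹k' ≠ j'›, xk _ _ k hk hk']
      linarith
  have hnorm : ∀ s t, CoversRight (covector h (x s t)) →
      (fun k => x s t k - x s t j₀) ∈ polyhedralSupport (boundedCells j₀ h) := fun s t hst =>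
    mem_polyhedralSupport_boundedCells.2 ⟨sub_self _, by rwa [covector_sub_const]⟩
  have hm := hconv.midpoint_mem (hnorm _ _ hP₁) (hnorm _ _ hP₂)
  have hmid : midpoint ℝ (fun k => x δ 0 k - x δ 0 j₀) (fun k => x 0 δ k - x 0 δ j₀) =
      fun k => x (δ / 2) (δ / 2) k - (x δ 0 j₀ + x 0 δ j₀) / 2 := by
    ext k
    have : (x δ 0 k + x 0 δ k) / 2 = x (δ / 2) (δ / 2) k := by
      refine cases3 (P := fun k => (x δ 0 k + x 0 δ k) / 2 = x (δ / 2) (δ / 2) k) ?_ ?_ ?_ k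
      · simp [xj']
      · simp only [xj]
        ring
      · intro k hk hk'
        simp only [xk _ _ k hk hk']
        ring
    rw [← this]
    simp [midpoint_eq_smul_add]
    ring
  rw [mem_polyhedralSupport_boundedCells, hmid, covector_sub_const] at hm
  obtain ⟨a, ha⟩ := hm.2 j'
  by_cases hai : a = i₀
  · have := ha j
    simp only [xj, xj', hai] at this
    linarith
  · have h3 := ha k₀
    have h4 := hmax a hai
    simp only [xk _ _ k₀ hkj hkj', xj'] at h3 h4
    linarith

theorem IsNoncrossingHeight.nonempty_covectorAbove_orderIso [Finite I] [Fintype J]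
    (hh : IsNoncrossingHeight l h) (hl : ∀ i, Function.Injective (l i))
    (hl' : ∀ j, Function.Injective fun i => l i j) (hGL : CoversLeft G) (hGR : CoversRight G)
    (j₀ : J) : Nonempty (CovectorAbove j₀ h G ≃o NoncrossingAbove (ArcCross l) G) := by
  refine ⟨⟨Equiv.subtypeEquivRight fun G' => and_congr_right fun hGG => ?_, Iff.rfl⟩⟩
  constructor
  · rintro ⟨x, -, rfl⟩
    exact hh.isNoncrossing_covector x
  · intro hG'
    exact hh.exists_covector_eq hl hl' hG' (hGL.mono hGG) (hGR.mono hGG) j₀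

/-- The face poset of a cell, in terms of noncrossing graphs. -/
theorem IsNoncrossingHeight.nonempty_face_orderIso [Fintype I] [Fintype J]
    (hh : IsNoncrossingHeight l h) (hl : ∀ i, Function.Injective (l i))
    (hl' : ∀ j, Function.Injective fun i => l i j) (hGL : CoversLeft G) (hGR : CoversRight G)
    (j₀ : J) : Nonempty (NonemptyFace (cell j₀ h G) ≃o (NoncrossingAbove (ArcCross l) G)ᵒᵈ) := by
  obtain ⟨f⟩ := nonempty_orderIso_nonemptyFace_cell (h := h) (j₀ := j₀) hGL
  obtain ⟨g⟩ := hh.nonempty_covectorAbove_orderIso hl hl' hGL hGR j₀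
  exact ⟨f.trans g.dual⟩

/-- At `x` all nontrivial constraints are strict, so the cell contains a neighbourhood of `x` in the
hyperplane where the coordinate at `j₀` vanishes. -/
theorem finrank_vectorSpan_cell [Finite I] [Fintype J] {x : J → ℝ} (hx : x j₀ = 0)
    (hG : ∀ p : I × J, p ∈ G → ∀ k, k ≠ p.2 → x k - h p.1 k < x p.2 - h p.1 p.2) :
    Module.finrank ℝ (vectorSpan ℝ (cell j₀ h G)) = Fintype.card J - 1 := by
  classical
  let f : Module.Dual ℝ (J → ℝ) := LinearMap.proj j₀
  have hf : f ≠ 0 := fun h0 => by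
    have := LinearMap.congr_fun h0 (fun _ => (1 : ℝ))
    simp [f] at this
  have hspan : vectorSpan ℝ (cell j₀ h G) = LinearMap.ker f := by
    refine le_antisymm (Submodule.span_le.2 ?_) fun v hv => ?_
    · rintro _ ⟨a, ha, b, hb, rfl⟩
      simp [f, ha.1, hb.1]
    · have hv0 : v j₀ = 0 := hv
      obtain ⟨ε, hε, hlt⟩ := exists_eps_of_finite
        (fun q : {q : (I × J) × J // q.1 ∈ G ∧ q.2 ≠ q.1.2} =>
          (x q.1.1.2 - h q.1.1.1 q.1.1.2) - (x q.1.2 - h q.1.1.1 q.1.2))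
        (fun q => v q.1.2 - v q.1.1.2) fun q => sub_pos.2 (hG _ q.2.1 _ q.2.2)
      have hmem : x + ε • v ∈ cell j₀ h G := by
        refine ⟨by simp [hx, hv0], fun p hp k => ?_⟩
        by_cases hk : k = p.2
        · rw [hk]
        · have := hlt ⟨(p, k), hp, hk⟩
          simp only [Pi.add_apply, Pi.smul_apply, smul_eq_mul] at this ⊢
          linarith
      have hmem' : x ∈ cell j₀ h G := ⟨hx, fun p hp k => by
        by_cases hk : k = p.2
        · rw [hk]
        · exact (hG p hp k hk).le⟩
      have h1 := vsub_mem_vectorSpan ℝ hmem hmem'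
      simp only [vsub_eq_sub, add_sub_cancel_left] at h1
      simpa [smul_smul, inv_mul_cancel₀ hε.ne'] using Submodule.smul_mem _ ε⁻¹ h1
  have h1 := Module.Dual.finrank_ker_add_one_of_ne_zero hf
  rw [Module.finrank_fintype_fun_eq_card] at h1
  rw [hspan]
  omega

end Support

/-! ### The support as a cyclohedron, and the non-convex case. -/

section Cyclohedron

variable {n : ℕ} {I J : Finset ℕ} {h : I → J → ℝ}

theorem coversLeft_diagonalArcs (J : Type*) : CoversLeft (diagonalArcs J) := fun j => ⟨j, rfl⟩

theorem coversRight_diagonalArcs (J : Type*) : CoversRight (diagonalArcs J) := fun j => ⟨j, rfl⟩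

theorem isNoncrossingHeight_of_cyclic (hh : IsCyclicallyNoncrossingHeight n h) :
    IsNoncrossingHeight (arcLengths n I J) h := hh

theorem IsPredecessor.injective {ι : J → I} (hι : IsPredecessor n I J ι) (hI : ∀ i ∈ I, i ≤ n)
    (hJ : ∀ j ∈ J, j ≤ n) : Function.Injective ι := fun a b hab => by
  have h1 := hι.right a b
  have h2 := hι.right b a
  rw [← hab] at h2
  exact Subtype.ext
    (arcLength_injective_right (hI _ (ι a).2) (hJ _ a.2) (hJ _ b.2) (le_antisymm h1 h2))

/-- For k ≠ j and i ≠ ι j the arcs (i, k) and (ι j, j) do not cross, because (ι j, j) is shortest in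
its row and column. The height inequality then makes the constraint of ι j at j implied by that of
i, so j is covered exactly when ι j covers it. -/
theorem IsPredecessor.support_eq {ι : J → I} (hι : IsPredecessor n I J ι)
    (hh : IsCyclicallyNoncrossingHeight n h) (hJ : Nontrivial J) (j₀ : J) :
    polyhedralSupport (boundedCells j₀ h) = cell j₀ (fun j => h (ι j)) (diagonalArcs J) := by
  ext x
  rw [mem_polyhedralSupport_boundedCells]
  refine and_congr_right fun _ => ⟨fun hx => ?_, fun hx j =>
    ⟨ι j, fun k => hx (show (j, j) ∈ diagonalArcs J from rfl) k⟩⟩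
  rintro ⟨j, j'⟩ hj k
  obtain rfl : j = j' := hj
  obtain ⟨i, hi⟩ := hx j
  by_cases hk : k = j
  · subst hk
    exact le_rfl
  have h1 := hi k
  simp only at h1 ⊢
  by_cases hij : i = ι j
  · rwa [hij] at h1
  have h2 := hh i (ι j) k j hij (fun he => hk (Subtype.ext_iff.2 (congrArg _ he))) <| by
    rintro (⟨-, hc⟩ | ⟨-, hc⟩)
    · exact absurd (hι.right j k) (not_le.2 hc)
    · exact absurd (hι.left i j) (not_le.2 hc)
  linarith

theorem cyclo_eq_boundedCells (h : I → J → ℝ) (hJ : J.Nonempty) :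
    Cyclo h = boundedCells ⟨J.max' hJ, J.max'_mem hJ⟩ h := by
  have : ∀ G : Set (I × J), tropicalCell h G = cell ⟨J.max' hJ, J.max'_mem hJ⟩ h G := fun G => by
    ext x
    refine and_congr ⟨fun hx => hx _ fun k => J.le_max' k k.2, fun hx j hj => ?_⟩ Iff.rfl
    rw [← hx]
    congr 1
    exact Subtype.ext (le_antisymm (J.le_max' j j.2) (hj ⟨J.max' hJ, J.max'_mem hJ⟩))
  simp only [Cyclo, boundedCells, this, CoversLeft]

theorem arcLengths_injective_right (hI : ∀ i ∈ I, i ≤ n) (hJ : ∀ j ∈ J, j ≤ n) (i : I) :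
    Function.Injective (arcLengths n I J i) := fun _ _ he =>
  Subtype.ext (arcLength_injective_right (hI _ i.2) (hJ _ (Subtype.prop _)) (hJ _ (Subtype.prop _)) he)

theorem arcLengths_injective_left (hI : ∀ i ∈ I, i ≤ n) (hJ : ∀ j ∈ J, j ≤ n) (j : J) :
    Function.Injective fun i => arcLengths n I J i j := fun _ _ he =>
  Subtype.ext (arcLength_injective_left (hI _ (Subtype.prop _)) (hI _ (Subtype.prop _)) (hJ _ j.2) he)

theorem isProduct_of_mem_boundedCells (hI : ∀ i ∈ I, i ≤ n) (hJ : ∀ j ∈ J, j ≤ n)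
    (hh : IsCyclicallyNoncrossingHeight n h) (hJ2 : Nontrivial J) {j₀ : J} {C : Set (J → ℝ)}
    (hC : C ∈ boundedCells j₀ h) : IsProductOfAssociahedraAndAtMostOneCyclohedron C := by
  obtain ⟨G, hG, rfl, hne, hb⟩ := hC
  obtain ⟨x, hx, he⟩ := cell_eq_cell_covector hG hne
  rw [he] at hb ⊢
  have hL := coversLeft_covector h x
  have hR := coversRight_of_isBounded hx.1 hJ2 hb
  have hnc := (isNoncrossingHeight_of_cyclic hh).isNoncrossing_covector x
  obtain ⟨f⟩ := (isNoncrossingHeight_of_cyclic hh).nonempty_face_orderIso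
    (arcLengths_injective_right hI hJ) (arcLengths_injective_left hI hJ) hL hR j₀
  obtain ⟨k, a, b, ⟨g⟩⟩ := exists_orderIso_noncrossingAbove hI hJ hL hR hnc
  -- The cyclohedral alternative always applies: for `b = 0` the polygon is a 2-gon and that factor
  -- is a single point.
  exact ⟨cell_isPolytope hb, k, a, Or.inr ⟨b, ⟨f.trans g.dual⟩⟩⟩

/-- The face poset theorem applies to the heights restricted along the injective ι, with J × J as
set of arcs. The diagonal graph is itself a covector, so its cell has a point where all other
constraints are strict, which gives full dimension. -/
theorem IsPredecessor.isCyclohedron {ι : J → I} (hι : IsPredecessor n I J ι)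
    (hI : ∀ i ∈ I, i ≤ n) (hJ : ∀ j ∈ J, j ≤ n) (hh : IsCyclicallyNoncrossingHeight n h)
    (j₀ : J) :
    IsCyclohedron (J.card - 1) (cell j₀ (fun j => h (ι j)) (diagonalArcs J)) ∧
    Module.finrank ℝ (vectorSpan ℝ (cell j₀ (fun j => h (ι j)) (diagonalArcs J))) =
      J.card - 1 := by
  have hinj := hι.injective hI hJ
  have hh' : IsNoncrossingHeight (fun j => arcLengths n I J (ι j)) fun j => h (ι j) :=
    fun a a' j j' ha hj hc => hh _ _ j j' (hinj.ne ha) hj hc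
  have hl : ∀ j, Function.Injective (arcLengths n I J (ι j)) := fun j =>
    arcLengths_injective_right hI hJ _
  have hl' : ∀ j, Function.Injective fun a => arcLengths n I J (ι a) j := fun j =>
    (arcLengths_injective_left hI hJ j).comp hinj
  have hL := coversLeft_diagonalArcs J
  have hR := coversRight_diagonalArcs J
  obtain ⟨f⟩ := hh'.nonempty_face_orderIso hl hl' hL hR j₀
  obtain ⟨g⟩ := hι.nonempty_orderIso hI hJ
  obtain ⟨x, hx, hxd⟩ := hh'.exists_covector_eq hl hl' hι.isNoncrossing_diagonalArcs hL hR j₀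
  refine ⟨⟨cell_isPolytope (cell_isBounded hR), ⟨f.trans g.dual⟩⟩, ?_⟩
  rw [finrank_vectorSpan_cell hx, Fintype.card_coe]
  intro p hp k hk
  have hp' := hp
  rw [← hxd] at hp'
  refine (hp' k).lt_of_ne fun he => hk ?_
  have : (p.1, k) ∈ covector (fun j => h (ι j)) x := fun m => (hp' m).trans_eq he.symm
  rw [hxd] at this
  exact (show p.1 = k from this).symm.trans hp

/-- Let `j` and `j'` be the first two elements of J after `i`. Both come no later than `a`, so `i`
is also their nearest element of I. This makes the matchings needed for a reentrant corner
noncrossing; the third element of J supplies `k₀`. -/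
theorem not_convex_of_arcLength_lt (hI : ∀ i ∈ I, i ≤ n) (hJ : ∀ j ∈ J, j ≤ n)
    (hI2 : 2 ≤ I.card) (hJ3 : 3 ≤ J.card) (hh : IsCyclicallyNoncrossingHeight n h) (j₀ : J)
    {i a k : ℕ} (hi : i ∈ I) (ha : a ∈ J) (hk : k ∈ J) (hka : arcLength n i k < arcLength n i a)
    (hmin : ∀ i' ∈ I, arcLength n i a ≤ arcLength n i' a) :
    ¬ Convex ℝ (polyhedralSupport (boundedCells j₀ h)) := by
  obtain ⟨i₁, hi₁, hne⟩ := I.exists_mem_ne hI2 i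
  obtain ⟨j, hj, hjmin⟩ := J.exists_min_image (fun j => arcLength n i j) ⟨a, ha⟩
  have haj : a ≠ j := fun he => by
    have := hjmin k hk
    rw [he] at hka
    omega
  obtain ⟨j', hj', hjmin'⟩ := (J.erase j).exists_min_image (fun j => arcLength n i j)
    ⟨a, Finset.mem_erase.2 ⟨haj, ha⟩⟩
  obtain ⟨hjj, hj'J⟩ := Finset.mem_erase.1 hj'
  obtain ⟨k₀, hk₀, hkj'⟩ := (J.erase j).exists_mem_ne (by
    rw [Finset.card_erase_of_mem hj]
    omega) j'
  obtain ⟨hkj, hk₀J⟩ := Finset.mem_erase.1 hk₀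
  have hinj : ∀ b ∈ J, ∀ c ∈ J, b ≠ c → arcLength n i b ≤ arcLength n i c →
      arcLength n i b < arcLength n i c := fun b hb c hc hbc hle =>
    hle.lt_of_ne fun he => hbc (arcLength_injective_right (hI i hi) (hJ b hb) (hJ c hc) he)
  have hjlt := hinj j hj j' hj'J hjj.symm (hjmin j' hj'J)
  have hleft : ∀ b ∈ J, arcLength n i b ≤ arcLength n i a → ∀ i' ∈ I,
      arcLength n i b ≤ arcLength n i' b := fun b hb hba i' hi' => by
    have h1 := hmin i' hi'
    rw [← not_lt] at hba h1 ⊢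
    rw [arcLength_lt_left_iff (hI _ hi) (hI _ hi') (hJ _ ha)] at h1
    rw [arcLength_lt_right_iff (hI _ hi) (hJ _ ha) (hJ _ hb)] at hba
    rw [arcLength_lt_left_iff (hI _ hi) (hI _ hi') (hJ _ hb)]
    omega
  have hj'a := hjmin' a (Finset.mem_erase.2 ⟨haj, ha⟩)
  refine not_convex_support (i₀ := ⟨i, hi⟩) (i₁ := ⟨i₁, hi₁⟩) (j := ⟨j, hj⟩) (j' := ⟨j', hj'J⟩)
    (k₀ := ⟨k₀, hk₀J⟩) (fun he => hne (congrArg Subtype.val he))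
    (fun he => hjj.symm (congrArg Subtype.val he)) (fun he => hkj (congrArg Subtype.val he))
    (fun he => hkj' (congrArg Subtype.val he)) (fun b c hb hcj hcj' => ?_) fun b hb => ?_
  · refine hh b ⟨i, hi⟩ c ⟨j', hj'J⟩ hb hcj' ?_
    have h1 := hjmin' c (Finset.mem_erase.2 ⟨fun he => hcj (Subtype.ext he), c.2⟩)
    rintro (⟨-, hc⟩ | ⟨-, hc⟩)
    · exact absurd h1 (not_le.2 hc)
    · exact absurd (hleft j' hj'J hj'a b b.2) (not_le.2 hc)
  · refine hh ⟨i, hi⟩ b ⟨j, hj⟩ ⟨j', hj'J⟩ (Ne.symm hb)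
      (fun he => hjj.symm (congrArg Subtype.val he)) ?_
    rintro (⟨hc, -⟩ | ⟨hc, -⟩)
    · exact absurd (hleft j hj (hjlt.le.trans hj'a) b b.2) (not_le.2 hc)
    · exact absurd hjlt (not_lt.2 hc.le)

end Cyclohedron

theorem mainTheorem11 (n : ℕ) (I J : Finset ℕ)
    (hI : ∀ i ∈ I, i ≤ n) (hJ : ∀ j ∈ J, j ≤ n)
    (hI2 : 2 ≤ I.card) (hJ3 : 3 ≤ J.card)
    (h : I → J → ℝ) (hh : IsCyclicallyNoncrossingHeight n h) :
    (Convex ℝ (polyhedralSupport (Cyclo h)) ↔ ¬ HasCyclicallyConsecutivePair I J) ∧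
    (¬ HasCyclicallyConsecutivePair I J →
      IsRegularSubdivision (Cyclo h) (polyhedralSupport (Cyclo h)) ∧
      IsCyclohedron (J.card - 1) (polyhedralSupport (Cyclo h)) ∧
      Module.finrank ℝ (vectorSpan ℝ (polyhedralSupport (Cyclo h))) = J.card - 1) ∧
    (∀ C ∈ Cyclo h, IsProductOfAssociahedraAndAtMostOneCyclohedron C) := by
  have hIne : I.Nonempty := Finset.card_pos.1 (by omega)
  have hJne : J.Nonempty := Finset.card_pos.1 (by omega)
  have hJ2 : Nontrivial J := Finset.one_lt_card_iff_nontrivial.1 (by omega) |>.coe_sort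
  rw [cyclo_eq_boundedCells h hJne]
  generalize (⟨J.max' hJne, J.max'_mem hJne⟩ : J) = j₀
  have hpred : ¬ HasCyclicallyConsecutivePair I J → ∃ ι : J → I, IsPredecessor n I J ι :=
    fun hno => (exists_isPredecessor_or hIne).resolve_right fun hc =>
      hno ((hasCyclicallyConsecutivePair_iff hI hJ hIne).2 hc)
  have hconv : ¬ HasCyclicallyConsecutivePair I J →
      Convex ℝ (polyhedralSupport (boundedCells j₀ h)) := fun hno => by
    obtain ⟨ι, hι⟩ := hpred hno
    rw [hι.support_eq hh hJ2]
    exact cell_convex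
  refine ⟨⟨fun hc hpair => ?_, hconv⟩, fun hno => ?_, fun C hC => ?_⟩
  · obtain ⟨i, hi, a, ha, k, hk, hka, hmin⟩ := (hasCyclicallyConsecutivePair_iff hI hJ hIne).1 hpair
    exact not_convex_of_arcLength_lt hI hJ hI2 hJ3 hh j₀ hi ha hk hka hmin hc
  · refine ⟨isRegularSubdivision_boundedCells (hconv hno), ?_⟩
    obtain ⟨ι, hι⟩ := hpred hno
    rw [hι.support_eq hh hJ2]
    exact hι.isCyclohedron hI hJ hh j₀
  · exact isProduct_of_mem_boundedCells hI hJ hh hJ2 hC
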